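/- Let $d\in\{2,3\}$ and let $\Omega\subset\mathbb R^d$ be a bounded Lipschitz domain (open, connected, nonempty) with outward unit normal $n$. Let $b\in (C^\infty(\Omega)\cap C(\overline\Omega))^d$ be a vector field with $|b|=1$ in $\Omega$. Put $\nabla_\parallel\phi=(b\cdot\nabla\phi)\,b$, $\nabla_\perp\phi=\nabla\phi-\nabla_\parallel\phi$ and $\partial\Omega_D=\{x\in\partial\Omega : b(x)\cdot n(x)=0\}$. Let $(\cdot,\cdot)$ be the inner product of $L^2(\Omega)$, and define $$\mathcal V=\{\phi\in H^1(\Omega):\phi|_{\partial\Omega_D}=0\},\quad \mathcal G=\{\phi\in\mathcal V:\nabla_\parallel\phi=0\},\quad \mathcal A=\{\phi\in\mathcal V:(\phi,\psi)=0\ \ \forall\psi\in\mathcal G\}.$$ Hypothesis A. The set $\partial\Omega_D$ has nonempty interior relative to $\partial\Omega$; $A_\parallel\in L^\infty(\Omega)$, $A_\perp\in L^\infty(\Omega)^{d\times d}$, and there are constants $0<A_0\le A_1$ such that, for almost every $x\in\Omega$, $A_0\le A_\parallel(x)\le A_1$ and $A_0|v|^2\le v^tA_\perp(x)v\le A_1|v|^2$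 for all $v\in\mathbb R^d$; and $f\in L^2(\Omega)$. Hypothesis B. $\mathcal V=\mathcal G\oplus\mathcal A$ (an $L^2$-orthogonal sum), the $L^2$-orthogonal projection $P:\mathcal V\to\mathcal G$ is continuous in the $H^1$ norm, and there is a constant $c$ with $\|\phi-P\phi\|_{L^2(\Omega)}\le c\,\|\nabla_\parallel\phi\|_{L^2(\Omega)}$ for all $\phi\in\mathcal V$. Let $$a_\parallel(\phi,\psi)=\int_\Omega A_\parallel\nabla_\parallel\phi\cdot\nabla_\parallel\psi\,dx,\qquad a_\perp(\phi,\psi)=\int_\Omega (A_\perp\nabla_\perp\phi)\cdot\nabla_\perp\psi\,dx,$$ and consider the following problems. (P) Find $\phi^\varepsilon\in\mathcal V$ with $a_\parallel(\phi^\varepsilon,\psi)+\varepsilon a_\perp(\phi^\varepsilon,\psi)=\varepsilon(f,\psi)$ for all $\psi\in\mathcal V$. (L) Find $\phi^0\in\mathcal G$ with $a_\perp(\phi^0,\psi)=(f,\psi)$ for all $\psi\in\mathcal G$. (AP) Find $(p^\varepsilon,q^\varepsilon)\in\mathcal G\times\mathcal A$ with $$a_\perp(p^\varepsilon,\eta)+a_\perp(q^\varepsilon,\eta)=(f,\eta)\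 \ \forall\eta\in\mathcal G,\qquad a_\parallel(q^\varepsilon,\xi)+\varepsilon a_\perp(q^\varepsilon,\xi)+\varepsilon a_\perp(p^\varepsilon,\xi)=\varepsilon(f,\xi)\ \ \forall\xi\in\mathcal A.$$ Theorem. Assume Hypotheses A and B. For every $\varepsilon>0$, problem (AP) has a unique solution $(p^\varepsilon,q^\varepsilon)\in\mathcal G\times\mathcal A$, and $\phi^\varepsilon:=p^\varepsilon+q^\varepsilon$ is the unique solution of (P) in $\mathcal V$. There is a constant $C>0$, independent of $\varepsilon$ and of $f$, such that for all $0<\varepsilon<1$ $$\|\phi^\varepsilon\|_{H^1(\Omega)}\le C\|f\|_{L^2(\Omega)},\quad \|q^\varepsilon\|_{H^1(\Omega)}\le C\|f\|_{L^2(\Omega)},\quad \|p^\varepsilon\|_{H^1(\Omega)}\le C\|f\|_{L^2(\Omega)}.$$ Problem (L) has a unique solution $\phi^0\in\mathcal G$, and as $\varepsilon\to0^+$ one has, strongly in $H^1(\Omega)$, $\phi^\varepsilon\to\phi^0$, $p^\varepsilon\to\phi^0$ and $q^\varepsilon\to0$. -/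

import Mathlib

open MeasureTheory Filter Topology Set
open scoped ENNReal NNReal ContDiff

namespace AnisotropicAP

/-- The Euclidean space `ℝ^d`. -/
abbrev E (d : ℕ) : Type := EuclideanSpace ℝ (Fin d)

variable {d : ℕ}

/-! ### The geometry -/

/-- A bounded Lipschitz domain: open, connected (and nonempty), bounded, and near every boundary
point equal, after choosing a unit vector `e` as vertical direction, to the strict epigraph of a
Lipschitz function `γ` of the horizontal part `y - ⟪e, y⟫ e` of the point `y`. -/
structure IsBoundedLipschitzDomain (Ω : Set (E d)) : Prop where
  isOpen : IsOpen Ω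
  isConnected : IsConnected Ω
  isBounded : Bornology.IsBounded Ω
  lipschitz_boundary : ∀ x ∈ frontier Ω, ∃ (e : E d) (K : ℝ≥0) (γ : E d → ℝ) (U : Set (E d)),
    ‖e‖ = 1 ∧ LipschitzWith K γ ∧ IsOpen U ∧ x ∈ U ∧
      ∀ y ∈ U, (y ∈ Ω ↔ γ (y - inner ℝ e y • e) < inner ℝ e y)

/-- The anisotropy direction: a field of unit vectors, smooth in `Ω` and continuous up to the
boundary (so that it has values on `∂Ω`). -/
structure IsDirectionField (Ω : Set (E d)) (b : E d → E d) : Prop where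
  smooth : ContDiffOn ℝ ∞ b Ω
  continuousOn_closure : ContinuousOn b (closure Ω)
  norm_eq_one : ∀ x ∈ Ω, ‖b x‖ = 1

/-- `n` is the outward unit normal to `Ω` at the boundary point `x`: near `x`, the set `Ω`
coincides, up to arbitrarily thin cones around the tangent hyperplane, with the half-space
`{y | ⟪n, y - x⟫ < 0}`. -/
def IsOutwardNormal (Ω : Set (E d)) (x n : E d) : Prop :=
  ‖n‖ = 1 ∧ ∀ c : ℝ, 0 < c → ∀ᶠ y in 𝓝 x,
    (inner ℝ n (y - x) < -(c * ‖y - x‖) → y ∈ Ω) ∧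
    (c * ‖y - x‖ < inner ℝ n (y - x) → y ∉ Ω)

/-- The Dirichlet part `∂Ω_D = {x ∈ ∂Ω | b(x) · n = 0}` of the boundary. -/
def dirichletBoundary (Ω : Set (E d)) (b : E d → E d) : Set (E d) :=
  {x | x ∈ frontier Ω ∧ ∃ n, IsOutwardNormal Ω x n ∧ inner ℝ (b x) n = 0}

/-! ### The Sobolev space `H¹(Ω)` -/

/-- `L²(Ω)`. -/
abbrev L2 (Ω : Set (E d)) : Type := Lp ℝ 2 (volume.restrict Ω)

/-- `L²(Ω)^d`. -/
abbrev L2vec (Ω : Set (E d)) : Type := Lp (E d) 2 (volume.restrict Ω)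

/-- `g` is the weak gradient of `u` in `Ω`. -/
def IsWeakGradient (Ω : Set (E d)) (u : E d → ℝ) (g : E d → E d) : Prop :=
  ∀ ψ : E d → ℝ, ContDiff ℝ ∞ ψ → HasCompactSupport ψ → tsupport ψ ⊆ Ω → ∀ v : E d,
    ∫ x in Ω, u x * fderiv ℝ ψ x v = - ∫ x in Ω, inner ℝ (g x) v * ψ x

theorem integrable_mul_fderiv {Ω : Set (E d)} (u : L2 Ω) {ψ : E d → ℝ} (hψ : ContDiff ℝ ∞ ψ)
    (hc : HasCompactSupport ψ) (v : E d) :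
    Integrable (fun x => u x * fderiv ℝ ψ x v) (volume.restrict Ω) := by
  have h1 : Continuous (fun x => fderiv ℝ ψ x v) :=
    (hψ.continuous_fderiv (by simp)).clm_apply continuous_const
  have h2 : HasCompactSupport (fun x => fderiv ℝ ψ x v) := hc.fderiv_apply (𝕜 := ℝ) v
  exact MemLp.integrable_mul (p := 2) (q := 2) (Lp.memLp u) (h1.memLp_of_hasCompactSupport h2)

theorem integrable_inner_mul {Ω : Set (E d)} (g : L2vec Ω) {ψ : E d → ℝ} (hψ : ContDiff ℝ ∞ ψ)
    (hc : HasCompactSupport ψ) (v : E d) :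
    Integrable (fun x => inner ℝ (g x) v * ψ x) (volume.restrict Ω) :=
  MemLp.integrable_mul (p := 2) (q := 2) ((Lp.memLp g).inner_const v)
    (hψ.continuous.memLp_of_hasCompactSupport hc)

/-- The Hilbert space `H¹(Ω)`: the pairs `(u, ∇u)` in `L²(Ω) × L²(Ω)^d` whose second component is
the weak gradient of the first, with `‖u‖_{H¹}² = ‖u‖_{L²}² + ‖∇u‖_{L²}²`. -/
def H1 (Ω : Set (E d)) : Submodule ℝ (WithLp 2 (L2 Ω × L2vec Ω)) where
  carrier := {w | IsWeakGradient Ω w.fst w.snd}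
  zero_mem' := by
    intro ψ hψ hc hs v
    have h1 : ∫ x in Ω, ((0 : L2 Ω) x) * fderiv ℝ ψ x v = 0 := by
      rw [← integral_zero (E d) ℝ (μ := volume.restrict Ω)]
      refine integral_congr_ae ?_
      filter_upwards [Lp.coeFn_zero ℝ 2 (volume.restrict Ω)] with x hx
      rw [hx, Pi.zero_apply, zero_mul]
    have h2 : ∫ x in Ω, inner ℝ ((0 : L2vec Ω) x) v * ψ x = 0 := by
      rw [← integral_zero (E d) ℝ (μ := volume.restrict Ω)]
      refine integral_congr_ae ?_
      filter_upwards [Lp.coeFn_zero (E d) 2 (volume.restrict Ω)] with x hx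
      rw [hx, Pi.zero_apply, inner_zero_left, zero_mul]
    simp only [WithLp.zero_fst, WithLp.zero_snd]
    rw [h1, h2, neg_zero]
  add_mem' := by
    intro w z hw hz ψ hψ hc hs v
    have h1 : ∫ x in Ω, (w.fst + z.fst : L2 Ω) x * fderiv ℝ ψ x v
        = ∫ x in Ω, w.fst x * fderiv ℝ ψ x v + z.fst x * fderiv ℝ ψ x v := by
      refine integral_congr_ae ?_
      filter_upwards [Lp.coeFn_add w.fst z.fst] with x hx
      rw [hx, Pi.add_apply, add_mul]
    have h2 : ∫ x in Ω, inner ℝ ((w.snd + z.snd : L2vec Ω) x) v * ψ x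
        = ∫ x in Ω, inner ℝ (w.snd x) v * ψ x + inner ℝ (z.snd x) v * ψ x := by
      refine integral_congr_ae ?_
      filter_upwards [Lp.coeFn_add w.snd z.snd] with x hx
      rw [hx, Pi.add_apply, inner_add_left, add_mul]
    simp only [WithLp.add_fst, WithLp.add_snd]
    rw [h1, h2, integral_add (integrable_mul_fderiv _ hψ hc v) (integrable_mul_fderiv _ hψ hc v),
      integral_add (integrable_inner_mul _ hψ hc v) (integrable_inner_mul _ hψ hc v),
      hw ψ hψ hc hs v, hz ψ hψ hc hs v]
    ring
  smul_mem' := by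
    intro c w hw ψ hψ hc hs v
    have h1 : ∫ x in Ω, (c • w.fst : L2 Ω) x * fderiv ℝ ψ x v
        = ∫ x in Ω, c * (w.fst x * fderiv ℝ ψ x v) := by
      refine integral_congr_ae ?_
      filter_upwards [Lp.coeFn_smul c w.fst] with x hx
      rw [hx, Pi.smul_apply, smul_eq_mul, mul_assoc]
    have h2 : ∫ x in Ω, inner ℝ ((c • w.snd : L2vec Ω) x) v * ψ x
        = ∫ x in Ω, c * (inner ℝ (w.snd x) v * ψ x) := by
      refine integral_congr_ae ?_
      filter_upwards [Lp.coeFn_smul c w.snd] with x hx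
      rw [hx, Pi.smul_apply, real_inner_smul_left, mul_assoc]
    simp only [WithLp.smul_fst, WithLp.smul_snd]
    rw [h1, h2, integral_const_mul, integral_const_mul, hw ψ hψ hc hs v]
    ring

/-- The underlying `L²` function of an element of `H¹(Ω)`. -/
def val {Ω : Set (E d)} (φ : H1 Ω) : L2 Ω := (φ : WithLp 2 (L2 Ω × L2vec Ω)).fst

/-- The weak gradient of an element of `H¹(Ω)`. -/
def grad {Ω : Set (E d)} (φ : H1 Ω) : L2vec Ω := (φ : WithLp 2 (L2 Ω × L2vec Ω)).snd

/-- `∇_∥ φ = (b · ∇φ) b`. -/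
noncomputable def gradPar {Ω : Set (E d)} (b : E d → E d) (φ : H1 Ω) (x : E d) : E d :=
  inner ℝ (b x) (grad φ x) • b x

/-- `∇_⊥ φ = (Id - b ⊗ b) ∇φ = ∇φ - ∇_∥ φ`. -/
noncomputable def gradPerp {Ω : Set (E d)} (b : E d → E d) (φ : H1 Ω) (x : E d) : E d :=
  grad φ x - gradPar b φ x

/-- `φ ∈ H¹(Ω)` has trace `g` on the part `Γ` of `∂Ω`: some sequence of functions smooth up to the
boundary converges to `φ` in `H¹(Ω)`, while its restrictions to `Γ` converge to `g` in `L²(Γ)` with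
respect to the surface measure, i.e. the `(d-1)`-dimensional Hausdorff measure. -/
def HasTraceOn {Ω : Set (E d)} (Γ : Set (E d)) (φ : H1 Ω) (g : E d → ℝ) : Prop :=
  ∃ u : ℕ → E d → ℝ, (∀ k, ContDiff ℝ ∞ (u k)) ∧
    Tendsto (fun k => eLpNorm (fun x => u k x - val φ x) 2 (volume.restrict Ω)) atTop (𝓝 0) ∧
    Tendsto (fun k => eLpNorm (fun x => gradient (u k) x - grad φ x) 2 (volume.restrict Ω))
      atTop (𝓝 0) ∧
    Tendsto (fun k => eLpNorm (fun x => u k x - g x) 2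
      ((Measure.hausdorffMeasure ((d : ℝ) - 1)).restrict Γ)) atTop (𝓝 0)

theorem tendsto_eLpNorm_add {α F : Type*} [MeasurableSpace α] [NormedAddCommGroup F]
    {μ : Measure α} {f g h : ℕ → α → F} (hf : ∀ k, AEStronglyMeasurable (f k) μ)
    (hg : ∀ k, AEStronglyMeasurable (g k) μ)
    (hf0 : Tendsto (fun k => eLpNorm (f k) 2 μ) atTop (𝓝 0))
    (hg0 : Tendsto (fun k => eLpNorm (g k) 2 μ) atTop (𝓝 0))
    (hh : ∀ k, h k =ᵐ[μ] f k + g k) :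
    Tendsto (fun k => eLpNorm (h k) 2 μ) atTop (𝓝 0) := by
  refine tendsto_of_tendsto_of_tendsto_of_le_of_le tendsto_const_nhds
    (by simpa using hf0.add hg0) (fun _ => bot_le) (fun k => ?_)
  show eLpNorm (h k) 2 μ ≤ eLpNorm (f k) 2 μ + eLpNorm (g k) 2 μ
  rw [eLpNorm_congr_ae (hh k)]
  exact eLpNorm_add_le (hf k) (hg k) (by norm_num)

theorem tendsto_eLpNorm_smul {α F : Type*} [MeasurableSpace α] [NormedAddCommGroup F]
    [NormedSpace ℝ F] {μ : Measure α} {f h : ℕ → α → F} (c : ℝ)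
    (hf0 : Tendsto (fun k => eLpNorm (f k) 2 μ) atTop (𝓝 0))
    (hh : ∀ k, h k =ᵐ[μ] c • f k) :
    Tendsto (fun k => eLpNorm (h k) 2 μ) atTop (𝓝 0) := by
  have h1 : ∀ k, eLpNorm (h k) 2 μ = ‖c‖ₑ * eLpNorm (f k) 2 μ := fun k => by
    rw [eLpNorm_congr_ae (hh k), eLpNorm_const_smul]
  simp only [h1]
  simpa using ENNReal.Tendsto.const_mul hf0 (Or.inr (enorm_ne_top (x := c)))

theorem continuous_gradient {u : E d → ℝ} (hu : ContDiff ℝ ∞ u) : Continuous (gradient u) :=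
  (InnerProductSpace.toDual ℝ (E d)).symm.continuous.comp (hu.continuous_fderiv (by simp))

/-! ### The spaces `𝒱`, `𝒢` and `𝒜` -/

/-- `𝒱 = {φ ∈ H¹(Ω) | φ = 0 on ∂Ω_D}`. -/
def spaceV (Ω : Set (E d)) (b : E d → E d) : Submodule ℝ (H1 Ω) where
  carrier := {φ | HasTraceOn (dirichletBoundary Ω b) φ 0}
  zero_mem' := by
    refine ⟨fun _ _ => 0, fun _ => contDiff_const, ?_, ?_, ?_⟩
    · refine tendsto_const_nhds.congr fun k => ?_
      rw [← eLpNorm_zero (p := 2) (μ := volume.restrict Ω) (ε := ℝ)]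
      refine eLpNorm_congr_ae ?_
      filter_upwards [Lp.coeFn_zero ℝ 2 (volume.restrict Ω)] with x hx
      have : val (0 : H1 Ω) = 0 := rfl
      rw [this, hx]
      simp
    · refine tendsto_const_nhds.congr fun k => ?_
      rw [← eLpNorm_zero (p := 2) (μ := volume.restrict Ω) (ε := E d)]
      refine eLpNorm_congr_ae ?_
      filter_upwards [Lp.coeFn_zero (E d) 2 (volume.restrict Ω)] with x hx
      have : grad (0 : H1 Ω) = 0 := rfl
      rw [this, hx]
      simp [gradient]
    · simp
  add_mem' := by
    rintro φ ψ ⟨u, hu, hu1, hu2, hu3⟩ ⟨w, hw, hw1, hw2, hw3⟩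
    refine ⟨fun k x => u k x + w k x, fun k => (hu k).add (hw k), ?_, ?_, ?_⟩
    · refine tendsto_eLpNorm_add
        (fun k => (hu k).continuous.aestronglyMeasurable.sub (Lp.aestronglyMeasurable _))
        (fun k => (hw k).continuous.aestronglyMeasurable.sub (Lp.aestronglyMeasurable _))
        hu1 hw1 (fun k => ?_)
      filter_upwards [Lp.coeFn_add (val φ) (val ψ)] with x hx
      have : val (φ + ψ) = val φ + val ψ := rfl
      simp only [this, hx, Pi.add_apply, Pi.sub_apply]
      ring
    · refine tendsto_eLpNorm_add
        (fun k => (continuous_gradient (hu k)).aestronglyMeasurable.sub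
          (Lp.aestronglyMeasurable _))
        (fun k => (continuous_gradient (hw k)).aestronglyMeasurable.sub
          (Lp.aestronglyMeasurable _)) hu2 hw2 (fun k => ?_)
      filter_upwards [Lp.coeFn_add (grad φ) (grad ψ)] with x hx
      have h0 : grad (φ + ψ) = grad φ + grad ψ := rfl
      have h1 : gradient (fun x => u k x + w k x) x = gradient (u k) x + gradient (w k) x := by
        unfold gradient
        rw [fderiv_fun_add ((hu k).differentiable (by simp) x)
          ((hw k).differentiable (by simp) x), map_add]
      simp only [h0, hx, h1, Pi.add_apply, Pi.sub_apply]
      abel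
    · refine tendsto_eLpNorm_add
        (fun k => (hu k).continuous.aestronglyMeasurable.sub aestronglyMeasurable_zero)
        (fun k => (hw k).continuous.aestronglyMeasurable.sub aestronglyMeasurable_zero)
        hu3 hw3 (fun k => ?_)
      refine Eventually.of_forall fun x => ?_
      simp
  smul_mem' := by
    rintro c φ ⟨u, hu, hu1, hu2, hu3⟩
    refine ⟨fun k x => c * u k x, fun k => contDiff_const.mul (hu k), ?_, ?_, ?_⟩
    · refine tendsto_eLpNorm_smul c hu1 (fun k => ?_)
      filter_upwards [Lp.coeFn_smul c (val φ)] with x hx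
      have : val (c • φ) = c • val φ := rfl
      simp only [this, hx, Pi.smul_apply, smul_eq_mul]
      ring
    · refine tendsto_eLpNorm_smul c hu2 (fun k => ?_)
      filter_upwards [Lp.coeFn_smul c (grad φ)] with x hx
      have h0 : grad (c • φ) = c • grad φ := rfl
      have h1 : gradient (fun x => c * u k x) x = c • gradient (u k) x := by
        unfold gradient
        rw [fderiv_const_mul ((hu k).differentiable (by simp) x)]
        simp
      simp only [h0, hx, h1, Pi.smul_apply, smul_sub]
    · refine tendsto_eLpNorm_smul c hu3 (fun k => ?_)
      refine Eventually.of_forall fun x => ?_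
      simp

/-- `𝒢 = {φ ∈ 𝒱 | ∇_∥ φ = 0}`. -/
def spaceG (Ω : Set (E d)) (b : E d → E d) : Submodule ℝ (H1 Ω) where
  carrier := {φ | φ ∈ spaceV Ω b ∧ ∀ᵐ x ∂(volume.restrict Ω), gradPar b φ x = 0}
  zero_mem' := by
    refine ⟨zero_mem _, ?_⟩
    filter_upwards [Lp.coeFn_zero (E d) 2 (volume.restrict Ω)] with x hx
    have : grad (0 : H1 Ω) = 0 := rfl
    rw [gradPar, this, hx, Pi.zero_apply, inner_zero_right, zero_smul]
  add_mem' := by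
    rintro φ ψ ⟨hφ, hφ'⟩ ⟨hψ, hψ'⟩
    refine ⟨add_mem hφ hψ, ?_⟩
    filter_upwards [hφ', hψ', Lp.coeFn_add (grad φ) (grad ψ)] with x h1 h2 hx
    have : grad (φ + ψ) = grad φ + grad ψ := rfl
    simp only [gradPar] at h1 h2 ⊢
    rw [this, hx, Pi.add_apply, inner_add_right, add_smul, h1, h2, add_zero]
  smul_mem' := by
    rintro c φ ⟨hφ, hφ'⟩
    refine ⟨Submodule.smul_mem _ c hφ, ?_⟩
    filter_upwards [hφ', Lp.coeFn_smul c (grad φ)] with x h1 hx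
    have : grad (c • φ) = c • grad φ := rfl
    simp only [gradPar] at h1 ⊢
    rw [this, hx, Pi.smul_apply, real_inner_smul_right, mul_smul, h1, smul_zero]

/-- `𝒜 = {φ ∈ 𝒱 | (φ, ψ) = 0 for all ψ ∈ 𝒢}`, with the inner product of `L²(Ω)`. -/
def spaceA (Ω : Set (E d)) (b : E d → E d) : Submodule ℝ (H1 Ω) where
  carrier := {φ | φ ∈ spaceV Ω b ∧ ∀ ψ ∈ spaceG Ω b, inner ℝ (val φ) (val ψ) = 0}
  zero_mem' := by
    refine ⟨zero_mem _, fun ψ _ => ?_⟩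
    have : val (0 : H1 Ω) = 0 := rfl
    rw [this, inner_zero_left]
  add_mem' := by
    rintro φ ψ ⟨hφ, hφ'⟩ ⟨hψ, hψ'⟩
    refine ⟨add_mem hφ hψ, fun χ hχ => ?_⟩
    have : val (φ + ψ) = val φ + val ψ := rfl
    rw [this, inner_add_left, hφ' χ hχ, hψ' χ hχ, add_zero]
  smul_mem' := by
    rintro c φ ⟨hφ, hφ'⟩
    refine ⟨Submodule.smul_mem _ c hφ, fun χ hχ => ?_⟩
    have : val (c • φ) = c • val φ := rfl
    rw [this, real_inner_smul_left, hφ' χ hχ, mul_zero]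

/-! ### The two hypotheses -/

/-- The hypothesis on the diffusion coefficients and the Dirichlet boundary: `∂Ω_D` has nonempty
interior relative to `∂Ω`, `A_∥` and the entries of `A_⊥` are in `L^∞(Ω)`, and both coefficients
are bounded from below and above by positive constants. -/
structure HypothesisA (Ω : Set (E d)) (b : E d → E d) (Apar : E d → ℝ)
    (Aperp : E d → Matrix (Fin d) (Fin d) ℝ) : Prop where
  interior_dirichlet : ∃ U : Set (E d), IsOpen U ∧ (U ∩ frontier Ω).Nonempty ∧
    U ∩ frontier Ω ⊆ dirichletBoundary Ω b
  memLp_par : MemLp Apar ∞ (volume.restrict Ω)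
  memLp_perp : ∀ i j, MemLp (fun x => Aperp x i j) ∞ (volume.restrict Ω)
  bounds : ∃ A₀ A₁ : ℝ, 0 < A₀ ∧
    (∀ᵐ x ∂(volume.restrict Ω), A₀ ≤ Apar x ∧ Apar x ≤ A₁) ∧
    ∀ᵐ x ∂(volume.restrict Ω), ∀ v : E d,
      A₀ * ‖v‖ ^ 2 ≤ inner ℝ v ((Aperp x).toEuclideanLin v) ∧
      inner ℝ v ((Aperp x).toEuclideanLin v) ≤ A₁ * ‖v‖ ^ 2

/-- The decomposition hypothesis: `𝒱 = 𝒢 ⊕ 𝒜` (the sum is `L²`-orthogonal by the definition of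
`𝒜`), the `L²`-orthogonal projection `P : 𝒱 → 𝒢` is continuous for the `H¹` norm, and the
Poincaré–Wirtinger inequality `‖φ - P φ‖_{L²} ≤ C ‖∇_∥ φ‖_{L²}` holds on `𝒱`. -/
structure HypothesisB (Ω : Set (E d)) (b : E d → E d) : Prop where
  decomposition : spaceG Ω b ⊔ spaceA Ω b = spaceV Ω b
  projection : ∃ P : spaceV Ω b →L[ℝ] spaceG Ω b,
    (∀ (φ : spaceV Ω b) (ψ : spaceG Ω b),
      inner ℝ (val (P φ : H1 Ω)) (val (ψ : H1 Ω)) = inner ℝ (val (φ : H1 Ω)) (val (ψ : H1 Ω))) ∧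
    ∃ C : ℝ≥0, ∀ φ : spaceV Ω b,
      eLpNorm (val (φ : H1 Ω) - val (P φ : H1 Ω) : L2 Ω) 2 (volume.restrict Ω)
        ≤ C * eLpNorm (gradPar b (φ : H1 Ω)) 2 (volume.restrict Ω)

/-! ### The bilinear forms and the three problems -/

/-- `a_∥(φ, ψ) = ∫_Ω A_∥ ∇_∥φ · ∇_∥ψ dx`. -/
noncomputable def aPar {Ω : Set (E d)} (b : E d → E d) (Apar : E d → ℝ) (φ ψ : H1 Ω) : ℝ :=
  ∫ x in Ω, Apar x * inner ℝ (gradPar b φ x) (gradPar b ψ x)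

/-- `a_⊥(φ, ψ) = ∫_Ω (A_⊥ ∇_⊥φ) · ∇_⊥ψ dx`. -/
noncomputable def aPerp {Ω : Set (E d)} (b : E d → E d) (Aperp : E d → Matrix (Fin d) (Fin d) ℝ)
    (φ ψ : H1 Ω) : ℝ :=
  ∫ x in Ω, inner ℝ ((Aperp x).toEuclideanLin (gradPerp b φ x)) (gradPerp b ψ x)

/-- `φ` is a (weak) solution of the singular perturbation problem (P). -/
def IsSolutionP {Ω : Set (E d)} (b : E d → E d) (Apar : E d → ℝ)
    (Aperp : E d → Matrix (Fin d) (Fin d) ℝ) (f : L2 Ω) (ε : ℝ) (φ : H1 Ω) : Prop :=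
  φ ∈ spaceV Ω b ∧ ∀ ψ ∈ spaceV Ω b,
    aPar b Apar φ ψ + ε * aPerp b Aperp φ ψ = ε * inner ℝ f (val ψ)

/-- `φ` is a solution of the limit problem (L). -/
def IsSolutionL {Ω : Set (E d)} (b : E d → E d)
    (Aperp : E d → Matrix (Fin d) (Fin d) ℝ) (f : L2 Ω) (φ : H1 Ω) : Prop :=
  φ ∈ spaceG Ω b ∧ ∀ ψ ∈ spaceG Ω b, aPerp b Aperp φ ψ = inner ℝ f (val ψ)

/-- `(p, q)` is a solution of the asymptotic preserving formulation. -/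
def IsSolutionAP {Ω : Set (E d)} (b : E d → E d) (Apar : E d → ℝ)
    (Aperp : E d → Matrix (Fin d) (Fin d) ℝ) (f : L2 Ω) (ε : ℝ) (p q : H1 Ω) : Prop :=
  p ∈ spaceG Ω b ∧ q ∈ spaceA Ω b ∧
  (∀ η ∈ spaceG Ω b, aPerp b Aperp p η + aPerp b Aperp q η = inner ℝ f (val η)) ∧
  (∀ ξ ∈ spaceA Ω b,
    aPar b Apar q ξ + ε * aPerp b Aperp q ξ + ε * aPerp b Aperp p ξ = ε * inner ℝ f (val ξ))

end AnisotropicAP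

namespace AnisotropicAP

variable {d : ℕ}

/-! ### A Poincaré inequality for smooth functions -/

/-! The argument is Hilbert-space coercivity on `𝒱`, plus an orthogonality argument for the limit.

Coercivity rests on a Poincaré–Friedrichs inequality on `𝒱` (`exists_norm_val_le_norm_grad`). For
smooth functions it is proved by moving sets. Integrating along vertical lines from the Dirichlet
part controls a small collar inside `Ω` (`IsGraphChart.exists_controlled`). Control then spreads
along segments in `Ω`, by connectedness in the interior and by pushing inward along chart directions
at the boundary (`IsBoundedLipschitzDomain.controlled`). Approximation by smooth functions carries
the inequality to `𝒱`.

With `R` and `S` the parallel and perpendicular gradients, the form of (P) dominates `ε ‖φ‖²` up to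
a constant when `ε < 1`. The right-hand side carries the same factor `ε`, so Lax–Milgram gives
well-posedness and a bound uniform in `ε`. Problem (L) is Lax–Milgram on `𝒢`, the kernel of `R` in
`𝒱`.

For convergence (`IsSplitCoercive.tendsto`), let `e = φ^ε - φ⁰` and let `m` represent the residual
of (L). Testing with `e` bounds `‖R e‖²` by a multiple of `ε`, and `‖e‖²` by a multiple of `⟪m, e⟫`.
As `m` is orthogonal to `ker R`, it is a limit of vectors `R* y`, and `⟪R* y, e⟫ = ⟪y, R e⟫ → 0`.
Strong convergence follows without compactness.

Finally (AP) is (P) split by the projection: `p = P φ^ε`, `q = φ^ε - P φ^ε`. Since `𝒢 ∩ 𝒜 = 0` the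
splitting is unique, and the `H¹` continuity of `P` transfers bounds and limits to `p` and `q`. -/

theorem ennreal_add_sq_le (x y : ℝ≥0∞) : (x + y) ^ 2 ≤ 2 * x ^ 2 + 2 * y ^ 2 := by
  have h := ENNReal.rpow_add_le_mul_rpow_add_rpow x y (p := 2) (by norm_num)
  norm_num at h
  rwa [mul_add] at h

theorem lintegral_sq_le {α : Type*} [MeasurableSpace α] (μ : Measure α) {g : α → ℝ≥0∞}
    (hg : AEMeasurable g μ) : (∫⁻ x, g x ∂μ) ^ 2 ≤ μ univ * ∫⁻ x, g x ^ 2 ∂μ := by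
  have h := ENNReal.lintegral_mul_le_Lp_mul_Lq μ (p := 2) (q := 2)
    ⟨by norm_num, by norm_num, by norm_num⟩ (f := fun _ => 1) aemeasurable_const hg
  simp only [Pi.mul_apply, one_mul, one_pow, lintegral_const, ENNReal.rpow_ofNat] at h
  calc (∫⁻ x, g x ∂μ) ^ 2
      ≤ (μ univ ^ (1 / 2 : ℝ) * (∫⁻ x, g x ^ 2 ∂μ) ^ (1 / 2 : ℝ)) ^ 2 := by gcongr
    _ = _ := by
      rw [mul_pow, ← ENNReal.rpow_natCast, ← ENNReal.rpow_natCast, ← ENNReal.rpow_mul,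
        ← ENNReal.rpow_mul]
      norm_num

/-- Fundamental theorem of calculus between `c` and `a`, then Cauchy–Schwarz on an interval of
length `T`. -/
theorem enorm_sq_le_of_hasDerivAt {v v' : ℝ → ℝ} (hv : ∀ s, HasDerivAt v (v' s) s)
    (hv' : Continuous v') {α T a c : ℝ} (ha : a ∈ Icc α (α + T)) (hc : c ∈ Icc α (α + T)) :
    ‖v a‖ₑ ^ 2 ≤ 2 * ‖v c‖ₑ ^ 2
      + 2 * (ENNReal.ofReal T * ∫⁻ s in Ioo α (α + T), ‖v' s‖ₑ ^ 2) := by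
  have h1 : v a = v c + ∫ s in c..a, v' s := by
    rw [intervalIntegral.integral_eq_sub_of_hasDerivAt (fun s _ => hv s)
      (hv'.intervalIntegrable _ _)]
    ring
  have h2 : ‖∫ s in c..a, v' s‖ₑ ≤ ∫⁻ s in Ioo α (α + T), ‖v' s‖ₑ := by
    have h4 : ‖∫ s in c..a, v' s‖ₑ = ‖∫ s in uIoc c a, v' s‖ₑ := by
      rw [← enorm_norm, intervalIntegral.norm_integral_eq_norm_integral_uIoc, enorm_norm]
    have h5 : uIoc c a ⊆ Ioc α (α + T) := fun s hs =>
      ⟨(le_min hc.1 ha.1).trans_lt hs.1, hs.2.trans (max_le hc.2 ha.2)⟩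
    rw [h4, restrict_Ioo_eq_restrict_Ioc]
    exact (enorm_integral_le_lintegral_enorm _).trans (lintegral_mono_set h5)
  have h3 := lintegral_sq_le (volume.restrict (Ioo α (α + T))) (g := fun s => ‖v' s‖ₑ)
    hv'.enorm.aemeasurable
  simp only [Measure.restrict_apply_univ, Real.volume_Ioo, add_sub_cancel_left] at h3
  calc ‖v a‖ₑ ^ 2 ≤ (‖v c‖ₑ + ∫⁻ s in Ioo α (α + T), ‖v' s‖ₑ) ^ 2 := by
        rw [h1]
        gcongr
        exact (enorm_add_le _ _).trans (by gcongr)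
    _ ≤ _ := (ennreal_add_sq_le _ _).trans (by gcongr)

theorem lintegral_translate_le {B D : Set (E d)} (hD : MeasurableSet D) (hB : MeasurableSet B)
    {h : E d} (hBD : ∀ x ∈ B, x + h ∈ D) (F : E d → ℝ≥0∞) :
    ∫⁻ x in B, F (x + h) ≤ ∫⁻ x in D, F x := by
  rw [← lintegral_indicator hB, ← lintegral_indicator hD,
    ← lintegral_add_right_eq_self (μ := volume) (D.indicator F) h]
  refine lintegral_mono fun x => ?_
  by_cases hx : x ∈ B
  · simp [hx, hBD x hx]
  · simp [hx]

/-- Integrate the one-dimensional estimate along the segments from `x` to `x + h` and swap the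
integrals: for each fixed `s`, the translate of `B` by `s • h` lies in `Ω`. The two endpoint
parameters have measure zero, so only open segments need to stay in `Ω`. -/
theorem lintegral_enorm_sq_le_translate {Ω B : Set (E d)} (hΩ : MeasurableSet Ω)
    (hB : MeasurableSet B) {h : E d} (hBΩ : ∀ x ∈ B, ∀ s ∈ Ioo (0 : ℝ) 1, x + s • h ∈ Ω)
    {u : E d → ℝ} (hu : ContDiff ℝ ∞ u) :
    ∫⁻ x in B, ‖u x‖ₑ ^ 2 ≤ 2 * (∫⁻ x in B, ‖u (x + h)‖ₑ ^ 2)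
      + 2 * (‖h‖ₑ ^ 2 * ∫⁻ x in Ω, ‖fderiv ℝ u x‖ₑ ^ 2) := by
  have hcont : Continuous (fderiv ℝ u) := hu.continuous_fderiv (by simp)
  have hpt : ∀ x : E d, ‖u x‖ₑ ^ 2 ≤ 2 * ‖u (x + h)‖ₑ ^ 2
      + 2 * ∫⁻ s in Ioo (0 : ℝ) 1, ‖h‖ₑ ^ 2 * ‖fderiv ℝ u (x + s • h)‖ₑ ^ 2 := by
    intro x
    have hline : ∀ s : ℝ, HasDerivAt (fun s : ℝ => u (x + s • h))
        (fderiv ℝ u (x + s • h) h) s := by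
      intro s
      have h1 : HasDerivAt (fun s : ℝ => x + s • h) h s := by
        simpa using ((hasDerivAt_id s).smul_const h).const_add x
      exact ((hu.differentiable (by simp) _).hasFDerivAt).comp_hasDerivAt s h1
    have h2 := enorm_sq_le_of_hasDerivAt hline (by fun_prop) (α := 0) (T := 1) (a := 0) (c := 1)
      (by simp) (by simp)
    simp only [zero_smul, add_zero, one_smul, zero_add, ENNReal.ofReal_one, one_mul] at h2
    refine h2.trans ?_
    gcongr with s
    rw [← mul_pow, mul_comm]
    gcongr
    exact ContinuousLinearMap.le_opENorm _ _
  have hmeas : Measurable (Function.uncurry fun (x : E d) (s : ℝ) =>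
      ‖h‖ₑ ^ 2 * ‖fderiv ℝ u (x + s • h)‖ₑ ^ 2) := by
    have : Continuous (Function.uncurry fun (x : E d) (s : ℝ) => fderiv ℝ u (x + s • h)) :=
      hcont.comp (by fun_prop)
    exact (this.enorm.measurable.pow_const 2).const_mul _
  calc ∫⁻ x in B, ‖u x‖ₑ ^ 2
      ≤ ∫⁻ x in B, (2 * ‖u (x + h)‖ₑ ^ 2
        + 2 * ∫⁻ s in Ioo (0 : ℝ) 1, ‖h‖ₑ ^ 2 * ‖fderiv ℝ u (x + s • h)‖ₑ ^ 2) :=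
        lintegral_mono hpt
    _ = 2 * (∫⁻ x in B, ‖u (x + h)‖ₑ ^ 2)
        + 2 * ∫⁻ s in Ioo (0 : ℝ) 1, ∫⁻ x in B, ‖h‖ₑ ^ 2 * ‖fderiv ℝ u (x + s • h)‖ₑ ^ 2 := by
        rw [lintegral_add_left, lintegral_const_mul', lintegral_const_mul',
          lintegral_lintegral_swap hmeas.aemeasurable]
        · simp
        · simp
        · exact ((hu.continuous.comp
            (continuous_add_const h)).enorm.measurable.pow_const 2).const_mul _
    _ ≤ 2 * (∫⁻ x in B, ‖u (x + h)‖ₑ ^ 2)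
        + 2 * ∫⁻ s in Ioo (0 : ℝ) 1, ‖h‖ₑ ^ 2 * ∫⁻ x in Ω, ‖fderiv ℝ u x‖ₑ ^ 2 := by
        gcongr 2 * _ + 2 * ?_
        refine setLIntegral_mono measurable_const fun s hs => ?_
        rw [lintegral_const_mul' _ _ (by simp)]
        exact mul_le_mul' le_rfl (lintegral_translate_le hΩ hB (fun x hx => hBΩ x hx s hs)
          (fun x => ‖fderiv ℝ u x‖ₑ ^ 2))
    _ = _ := by simp

/-- On `W`, the `L²` norm of a smooth function is controlled by the `L²(Ω)` norm of its gradient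
and its `L²(μ)` norm. -/
def Controlled (Ω : Set (E d)) (μ : Measure (E d)) (W : Set (E d)) : Prop :=
  ∃ C : ℝ≥0, ∀ u : E d → ℝ, ContDiff ℝ ∞ u →
    ∫⁻ x in W, ‖u x‖ₑ ^ 2 ≤ C * ((∫⁻ x in Ω, ‖fderiv ℝ u x‖ₑ ^ 2) + ∫⁻ x, ‖u x‖ₑ ^ 2 ∂μ)

theorem controlled_empty (Ω : Set (E d)) (μ : Measure (E d)) : Controlled Ω μ ∅ :=
  ⟨0, fun u _ => by simp⟩

theorem Controlled.mono {Ω : Set (E d)} {μ : Measure (E d)} {W W' : Set (E d)}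
    (h : Controlled Ω μ W) (hW : W' ⊆ W) : Controlled Ω μ W' := by
  obtain ⟨C, hC⟩ := h
  exact ⟨C, fun u hu => (lintegral_mono_set hW).trans (hC u hu)⟩

theorem Controlled.union {Ω : Set (E d)} {μ : Measure (E d)} {W W' : Set (E d)}
    (h : Controlled Ω μ W) (h' : Controlled Ω μ W') : Controlled Ω μ (W ∪ W') := by
  obtain ⟨C, hC⟩ := h
  obtain ⟨C', hC'⟩ := h'
  refine ⟨C + C', fun u hu => (lintegral_union_le _ _ _).trans ?_⟩
  rw [ENNReal.coe_add, add_mul]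
  exact add_le_add (hC u hu) (hC' u hu)

theorem Controlled.translate {Ω : Set (E d)} {μ : Measure (E d)} {B D : Set (E d)}
    (hΩ : MeasurableSet Ω) (hB : MeasurableSet B) (hD : MeasurableSet D)
    (h : Controlled Ω μ D) {v : E d} (hBD : ∀ x ∈ B, x + v ∈ D)
    (hBΩ : ∀ x ∈ B, ∀ s ∈ Ioo (0 : ℝ) 1, x + s • v ∈ Ω) : Controlled Ω μ B := by
  obtain ⟨C, hC⟩ := h
  refine ⟨2 * C + 2 * ‖v‖₊ ^ 2, fun u hu => ?_⟩
  refine (lintegral_enorm_sq_le_translate hΩ hB hBΩ hu).trans ?_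
  have h1 := (lintegral_translate_le hD hB hBD (fun x => ‖u x‖ₑ ^ 2)).trans (hC u hu)
  push_cast
  rw [add_mul, mul_assoc, mul_assoc]
  refine add_le_add (by gcongr) ?_
  gcongr
  · exact le_rfl
  · exact le_self_add

/-- Connectedness: the points with a controlled ball form an open set that is relatively closed in
`Ω`, because a small ball around a limit point can be translated onto a controlled one inside `Ω`.
-/
theorem exists_controlled_nhds_of_mem {Ω : Set (E d)} {μ : Measure (E d)} (hΩ : IsOpen Ω)
    (hconn : IsPreconnected Ω) {N : Set (E d)} (hN : IsOpen N) (hNne : N.Nonempty) (hNΩ : N ⊆ Ω)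
    (hNc : Controlled Ω μ N) {x : E d} (hx : x ∈ Ω) :
    ∃ r > 0, Controlled Ω μ (Metric.ball x r) := by
  set G : Set (E d) := {y | ∃ r > 0, Controlled Ω μ (Metric.ball y r)} with hG
  have hGo : IsOpen G := by
    refine Metric.isOpen_iff.2 fun y ⟨r, hr, hc⟩ => ⟨r, hr, fun z hz => ?_⟩
    refine ⟨r - dist z y, by simpa using hz, hc.mono (Metric.ball_subset_ball' (by simp))⟩
  suffices h : Ω ⊆ G from h hx
  refine hconn.subset_of_closure_inter_subset hGo ?_ ?_
  · obtain ⟨y, hy⟩ := hNne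
    obtain ⟨r, hr, hrN⟩ := Metric.isOpen_iff.1 hN y hy
    exact ⟨y, hNΩ hy, r, hr, hNc.mono hrN⟩
  · rintro y ⟨hyG, hyΩ⟩
    obtain ⟨r, hr, hrΩ⟩ := Metric.isOpen_iff.1 hΩ y hyΩ
    obtain ⟨z, ⟨s, hs, hzc⟩, hyz⟩ := Metric.mem_closure_iff.1 hyG (r / 2) (by positivity)
    -- The bound `s` makes the translated ball land in the controlled ball at `z`; the bound `r /
    -- 2`, with `dist y z < r / 2`, keeps the segments in the ball of radius `r` about `y`.
    refine ⟨min s (r / 2), by positivity, ?_⟩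
    refine Controlled.translate hΩ.measurableSet measurableSet_ball measurableSet_ball hzc
      (v := z - y) (fun x hx => ?_) (fun x hx t ht => hrΩ ?_)
    · rw [Metric.mem_ball, dist_eq_norm] at hx ⊢
      calc ‖x + (z - y) - z‖ = ‖x - y‖ := by congr 1; abel
        _ < s := hx.trans_le (min_le_left _ _)
    · rw [Metric.mem_ball, dist_eq_norm] at hx ⊢
      rw [dist_comm, dist_eq_norm] at hyz
      calc ‖x + t • (z - y) - y‖ = ‖(x - y) + t • (z - y)‖ := by congr 1; abel
        _ ≤ ‖x - y‖ + |t| * ‖z - y‖ := by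
          refine (norm_add_le _ _).trans ?_
          rw [norm_smul, Real.norm_eq_abs]
        _ ≤ ‖x - y‖ + 1 * ‖z - y‖ := by
          gcongr
          rw [abs_of_pos ht.1]; exact ht.2.le
        _ < r := by
          have := hx.trans_le (min_le_right _ _)
          linarith

theorem controlled_of_isCompact {Ω : Set (E d)} {μ : Measure (E d)} {K : Set (E d)}
    (hK : IsCompact K) (h : ∀ x ∈ K, ∃ r > 0, Controlled Ω μ (Metric.ball x r)) :
    Controlled Ω μ K :=
  hK.induction_on (controlled_empty _ _) (fun _ _ hs ht => ht.mono hs)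
    (fun _ _ hs ht => hs.union ht) fun x hx => by
      obtain ⟨r, hr, hc⟩ := h x hx
      exact ⟨_, mem_nhdsWithin_of_mem_nhds (Metric.ball_mem_nhds x hr), hc⟩

/-! ### The Poincaré inequality near the boundary -/

/-- A chart of the boundary: in the open set `U`, the set `Ω` is the strict epigraph of `γ` over
the hyperplane orthogonal to the unit vector `e`. -/
structure IsGraphChart (Ω : Set (E d)) (e : E d) (γ : E d → ℝ) (U : Set (E d)) : Prop where
  norm_eq_one : ‖e‖ = 1
  continuous : Continuous γ
  isOpen : IsOpen U
  mem_iff : ∀ y ∈ U, (y ∈ Ω ↔ γ (y - inner ℝ e y • e) < inner ℝ e y)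

theorem sub_inner_add_smul {e : E d} (he : ‖e‖ = 1) (y : E d) (t : ℝ) :
    (y + t • e) - inner ℝ e (y + t • e) • e = y - inner ℝ e y • e := by
  rw [inner_add_right, inner_smul_right, real_inner_self_eq_norm_sq, he]
  module

theorem inner_add_smul_self {e : E d} (he : ‖e‖ = 1) (y : E d) (t : ℝ) :
    inner ℝ e (y + t • e) = inner ℝ e y + t := by
  rw [inner_add_right, inner_smul_right, real_inner_self_eq_norm_sq, he]
  ring

namespace IsGraphChart

variable {Ω : Set (E d)} {e : E d} {γ : E d → ℝ} {U : Set (E d)}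

theorem le_of_mem_closure (h : IsGraphChart Ω e γ U) {y : E d} (hyU : y ∈ U)
    (hy : y ∈ closure Ω) : γ (y - inner ℝ e y • e) ≤ inner ℝ e y := by
  have hc := h.continuous
  by_contra! hlt
  have ho : IsOpen {z | inner ℝ e z < γ (z - inner ℝ e z • e)} :=
    isOpen_lt (by fun_prop) (by fun_prop)
  obtain ⟨z, ⟨hz, hzU⟩, hzΩ⟩ := mem_closure_iff.1 hy _ (ho.inter h.isOpen) ⟨hlt, hyU⟩
  exact lt_asymm hz ((h.mem_iff z hzU).1 hzΩ)

theorem eq_of_mem_frontier (h : IsGraphChart Ω e γ U) (hΩ : IsOpen Ω) {y : E d} (hyU : y ∈ U)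
    (hy : y ∈ frontier Ω) : γ (y - inner ℝ e y • e) = inner ℝ e y := by
  refine le_antisymm (h.le_of_mem_closure hyU hy.1) (not_lt.1 fun hlt => ?_)
  have := (h.mem_iff y hyU).2 hlt
  rw [hΩ.frontier_eq] at hy
  exact hy.2 this

/-- Near the boundary, points of `closure Ω` are pushed into `Ω` by the direction of the chart. -/
theorem exists_push (h : IsGraphChart Ω e γ U) {x : E d} (hx : x ∈ U) :
    ∃ r > 0, ∃ τ > 0, ∀ y ∈ Metric.closedBall x r ∩ closure Ω, ∀ t ∈ Ioc (0 : ℝ) τ,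
      y + t • e ∈ Ω := by
  obtain ⟨ρ, hρ, hρU⟩ := Metric.isOpen_iff.1 h.isOpen x hx
  refine ⟨ρ / 3, by positivity, ρ / 3, by positivity, fun y hy t ht => ?_⟩
  have hyx : dist y x ≤ ρ / 3 := hy.1
  have hyU : y ∈ U := hρU (by rw [Metric.mem_ball]; linarith)
  have htU : y + t • e ∈ U := hρU <| by
    rw [Metric.mem_ball]
    calc dist (y + t • e) x ≤ dist (y + t • e) y + dist y x := dist_triangle _ _ _
      _ = t + dist y x := by
        rw [dist_eq_norm, add_sub_cancel_left, norm_smul, h.norm_eq_one, Real.norm_eq_abs,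
          abs_of_pos ht.1, mul_one]
      _ < ρ := by have := ht.2; linarith
  rw [h.mem_iff _ htU, sub_inner_add_smul h.norm_eq_one, inner_add_smul_self h.norm_eq_one]
  have := h.le_of_mem_closure hyU hy.2
  have := ht.1
  linarith

end IsGraphChart

/-- If some nonempty open subset of `Ω` is controlled, so is all of `Ω`. -/
theorem IsBoundedLipschitzDomain.controlled {Ω : Set (E d)} {μ : Measure (E d)}
    (hΩ : IsBoundedLipschitzDomain Ω) {N : Set (E d)} (hN : IsOpen N) (hNne : N.Nonempty)
    (hNΩ : N ⊆ Ω) (hNc : Controlled Ω μ N) : Controlled Ω μ Ω := by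
  have hint : ∀ x ∈ Ω, ∃ r > 0, Controlled Ω μ (Metric.ball x r) := fun x hx =>
    exists_controlled_nhds_of_mem hΩ.isOpen hΩ.isConnected.isPreconnected hN hNne hNΩ hNc hx
  have hcomp : IsCompact (closure Ω) := hΩ.isBounded.isCompact_closure
  refine Controlled.mono (W := closure Ω ∩ Ω) ?_ (fun x hx => ⟨subset_closure hx, hx⟩)
  refine hcomp.induction_on (p := fun s => Controlled Ω μ (s ∩ Ω))
    (by simpa using controlled_empty _ _) (fun s t hs ht => ht.mono (by gcongr))
    (fun s t hs ht => by rw [union_inter_distrib_right]; exact hs.union ht) fun x hx => ?_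
  by_cases hxΩ : x ∈ Ω
  · obtain ⟨r, hr, hc⟩ := hint x hxΩ
    exact ⟨_, mem_nhdsWithin_of_mem_nhds (Metric.ball_mem_nhds x hr), hc.mono inter_subset_left⟩
  · have hxf : x ∈ frontier Ω := by
      rw [hΩ.isOpen.frontier_eq]; exact ⟨hx, hxΩ⟩
    obtain ⟨e, K, γ, U, he, hγ, hU, hxU, hy⟩ := hΩ.lipschitz_boundary x hxf
    have hchart : IsGraphChart Ω e γ U := ⟨he, hγ.continuous, hU, hy⟩
    obtain ⟨r, hr, τ, hτ, hpush⟩ := hchart.exists_push hxU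
    -- Pushed inward by `τ • e`, the part of `closure Ω` near `x` becomes a compact subset of `Ω`,
    -- where interior control applies; translation then carries control back up to the boundary.
    have hKc : IsCompact ((fun y => y + τ • e) '' (Metric.closedBall x r ∩ closure Ω)) :=
      (hcomp.inter_left Metric.isClosed_closedBall).image (by fun_prop)
    have hKcontr : Controlled Ω μ
        ((fun y => y + τ • e) '' (Metric.closedBall x r ∩ closure Ω)) := by
      refine controlled_of_isCompact hKc ?_
      rintro _ ⟨y, hy, rfl⟩
      exact hint _ (hpush y hy τ ⟨hτ, le_rfl⟩)
    refine ⟨_, mem_nhdsWithin_of_mem_nhds (Metric.ball_mem_nhds x hr), ?_⟩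
    refine hKcontr.translate hΩ.isOpen.measurableSet
      (measurableSet_ball.inter hΩ.isOpen.measurableSet) hKc.measurableSet (v := τ • e)
      (fun y hy => ⟨y, ⟨Metric.ball_subset_closedBall hy.1, subset_closure hy.2⟩, rfl⟩)
      fun y hy s hs => ?_
    rw [smul_smul]
    refine hpush y ⟨Metric.ball_subset_closedBall hy.1, subset_closure hy.2⟩ _
      ⟨mul_pos hs.1 hτ, ?_⟩
    have := hs.2
    nlinarith

/-! ### Coordinates adapted to a chart -/

/-- The hyperplane orthogonal to `e`. -/
noncomputable abbrev Hyper (e : E d) : Submodule ℝ (E d) := (ℝ ∙ e)ᗮ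

/-- The coordinates `(w, t) ↦ w + t e` on `ℝ^d`, for a unit vector `e`. -/
noncomputable def graphCoord (e : E d) (he : ‖e‖ = 1) : (Hyper e × ℝ) ≃L[ℝ] E d :=
  LinearEquiv.toContinuousLinearEquiv
    { toFun := fun z => (z.1 : E d) + z.2 • e
      map_add' := fun z z' => by simp only [Prod.fst_add, Prod.snd_add, Submodule.coe_add]; module
      map_smul' := fun c z => by
        simp only [Prod.smul_fst, Prod.smul_snd, Submodule.coe_smul, RingHom.id_apply]; module
      invFun := fun y => (⟨y - inner ℝ e y • e, by
        rw [Submodule.mem_orthogonal_singleton_iff_inner_right, inner_sub_right, inner_smul_right,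
          real_inner_self_eq_norm_sq, he]
        ring⟩, inner ℝ e y)
      left_inv := fun z => by
        have h : inner ℝ e (z.1 : E d) = 0 :=
          Submodule.mem_orthogonal_singleton_iff_inner_right.1 z.1.2
        ext1
        · ext1
          simp only [sub_inner_add_smul he, h, zero_smul, sub_zero]
        · simp only [inner_add_smul_self he, h, zero_add]
      right_inv := fun y => by simp }

theorem graphCoord_apply (e : E d) (he : ‖e‖ = 1) (w : Hyper e) (t : ℝ) :
    graphCoord e he (w, t) = (w : E d) + t • e := rfl

theorem coe_graphCoord_symm_fst (e : E d) (he : ‖e‖ = 1) (y : E d) :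
    (((graphCoord e he).symm y).1 : E d) = y - inner ℝ e y • e := rfl

theorem inner_hyper {e : E d} (w : Hyper e) : inner ℝ e (w : E d) = 0 :=
  Submodule.mem_orthogonal_singleton_iff_inner_right.1 w.2

/-- Pythagoras. The constant `1` ensures that the projection does not increase Hausdorff measure. -/
theorem lipschitzWith_graphCoord_symm_fst (e : E d) (he : ‖e‖ = 1) :
    LipschitzWith 1 (fun y => ((graphCoord e he).symm y).1) := by
  refine LipschitzWith.of_dist_le_mul fun y z => ?_
  rw [NNReal.coe_one, one_mul, Subtype.dist_eq, coe_graphCoord_symm_fst, coe_graphCoord_symm_fst,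
    dist_eq_norm, dist_eq_norm]
  have h1 : y - inner ℝ e y • e - (z - inner ℝ e z • e) = (y - z) - inner ℝ e (y - z) • e := by
    rw [inner_sub_right]; module
  rw [h1]
  refine le_of_sq_le_sq ?_ (norm_nonneg _)
  rw [norm_sub_sq_real, norm_smul, inner_smul_right, he, real_inner_comm, mul_one,
    Real.norm_eq_abs, sq_abs]
  nlinarith [sq_nonneg (inner ℝ e (y - z))]

theorem finrank_hyper {e : E d} (he : ‖e‖ = 1) :
    (Module.finrank ℝ (Hyper e) : ℝ) = (d : ℝ) - 1 := by
  have h1 := (ℝ ∙ e).finrank_add_finrank_orthogonal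
  rw [finrank_span_singleton (by rintro rfl; simp at he), finrank_euclideanSpace_fin] at h1
  rw [eq_sub_iff_add_eq']
  exact_mod_cast h1

/-- The surface measure on a hyperplane. -/
noncomputable abbrev hyperMeasure (e : E d) : Measure (Hyper e) :=
  Measure.hausdorffMeasure (Module.finrank ℝ (Hyper e))

/-- Uniqueness of Haar measure followed by Tonelli; the value of `c` plays no role. -/
theorem exists_lintegral_eq_graphCoord (e : E d) (he : ‖e‖ = 1) : ∃ c : ℝ≥0,
    ∀ F : E d → ℝ≥0∞, Measurable F →
      ∫⁻ x, F x = c * ∫⁻ w, ∫⁻ t, F ((w : E d) + (t : ℝ) • e) ∂volume ∂(hyperMeasure e) := by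
  have hmeas : Measurable (graphCoord e he) := (graphCoord e he).continuous.measurable
  set lam : Measure (E d) := Measure.map (graphCoord e he) ((hyperMeasure e).prod volume) with hlam
  have hh : lam.IsAddHaarMeasure := ContinuousLinearEquiv.isAddHaarMeasure_map _ _
  obtain ⟨c, hc⟩ : ∃ c : ℝ≥0, (volume : Measure (E d)) = c • lam :=
    ⟨_, Measure.isAddLeftInvariant_eq_smul _ _⟩
  refine ⟨c, fun F hF => ?_⟩
  rw [hc, lintegral_smul_measure, hlam, lintegral_map hF hmeas,
    lintegral_prod (fun z => F (graphCoord e he z)) (hF.comp hmeas).aemeasurable]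
  rfl

/-- The projection onto the hyperplane is 1-Lipschitz, so the surface measure of the graph, pushed
down, dominates the hyperplane measure. This one-sided comparison replaces the area formula. -/
theorem lintegral_graph_le {e : E d} (he : ‖e‖ = 1) {γ : E d → ℝ} (hγ : Continuous γ)
    {B : Set (Hyper e)} {Θ Γ : Set (E d)} (hΘ : MeasurableSet Θ)
    (hΘΓ : Θ ⊆ Γ) (hBΘ : ∀ w ∈ B, (w : E d) + γ w • e ∈ Θ)
    (hΘγ : ∀ y ∈ Θ, γ (y - inner ℝ e y • e) = inner ℝ e y)
    {F : E d → ℝ≥0∞} (hF : Measurable F) :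
    ∫⁻ w in B, F ((w : E d) + γ w • e) ∂(hyperMeasure e)
      ≤ ∫⁻ y in Γ, F y ∂(Measure.hausdorffMeasure ((d : ℝ) - 1)) := by
  set pr : E d → Hyper e := fun y => ((graphCoord e he).symm y).1 with hpr
  have hLip : LipschitzWith 1 pr := lipschitzWith_graphCoord_symm_fst e he
  have hprm : Measurable pr := hLip.continuous.measurable
  have hle : (hyperMeasure e).restrict B
      ≤ Measure.map pr ((Measure.hausdorffMeasure ((d : ℝ) - 1)).restrict Θ) := by
    refine Measure.le_iff.2 fun S hS => ?_
    rw [Measure.restrict_apply hS, Measure.map_apply hprm hS,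
      Measure.restrict_apply (hprm hS), ← finrank_hyper he]
    have hsub : S ∩ B ⊆ pr '' (pr ⁻¹' S ∩ Θ) := by
      rintro w ⟨hwS, hwB⟩
      have hw : pr ((w : E d) + γ w • e) = w := by
        ext1
        rw [hpr, coe_graphCoord_symm_fst, sub_inner_add_smul he, inner_hyper, zero_smul, sub_zero]
      exact ⟨_, ⟨by rw [mem_preimage, hw]; exact hwS, hBΘ w hwB⟩, hw⟩
    refine (measure_mono hsub).trans ((hLip.hausdorffMeasure_image_le (by positivity) _).trans ?_)
    simp
  have hγm : Measurable fun w : Hyper e => F ((w : E d) + γ w • e) := by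
    refine hF.comp (Continuous.measurable ?_)
    fun_prop
  calc ∫⁻ w in B, F ((w : E d) + γ w • e) ∂(hyperMeasure e)
      ≤ ∫⁻ w, F ((w : E d) + γ w • e)
          ∂(Measure.map pr ((Measure.hausdorffMeasure ((d : ℝ) - 1)).restrict Θ)) :=
        lintegral_mono' hle le_rfl
    _ = ∫⁻ y in Θ, F y ∂(Measure.hausdorffMeasure ((d : ℝ) - 1)) := by
        rw [lintegral_map hγm hprm]
        refine setLIntegral_congr_fun hΘ fun y hy => ?_
        simp only [hpr, coe_graphCoord_symm_fst]
        rw [hΘγ y hy, sub_add_cancel]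
    _ ≤ _ := lintegral_mono_set hΘΓ

theorem enorm_sq_le_along {e : E d} (he : ‖e‖ = 1) {u : E d → ℝ} (hu : ContDiff ℝ ∞ u)
    (w : E d) {α τ t : ℝ} (ht : t ∈ Ioo α (α + τ)) :
    ‖u (w + t • e)‖ₑ ^ 2 ≤ 2 * ‖u (w + α • e)‖ₑ ^ 2
      + 2 * (ENNReal.ofReal τ * ∫⁻ s in Ioo α (α + τ), ‖fderiv ℝ u (w + s • e)‖ₑ ^ 2) := by
  have hcont : Continuous (fderiv ℝ u) := hu.continuous_fderiv (by simp)
  have hline : ∀ s : ℝ, HasDerivAt (fun s : ℝ => u (w + s • e))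
      (fderiv ℝ u (w + s • e) e) s := by
    intro s
    have h1 : HasDerivAt (fun s : ℝ => w + s • e) e s := by
      simpa using ((hasDerivAt_id s).smul_const e).const_add w
    exact ((hu.differentiable (by simp) _).hasFDerivAt).comp_hasDerivAt s h1
  refine (enorm_sq_le_of_hasDerivAt hline (by fun_prop) (α := α) (T := τ) (a := t) (c := α)
    (Ioo_subset_Icc_self ht) ⟨le_rfl, (ht.1.trans ht.2).le⟩).trans ?_
  gcongr with s
  refine (ContinuousLinearMap.le_opENorm _ _).trans ?_
  rw [← ofReal_norm e, he, ENNReal.ofReal_one, mul_one]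

theorem setLIntegral_along_le {e : E d} (he : ‖e‖ = 1) {u : E d → ℝ} (hu : ContDiff ℝ ∞ u)
    (w : E d) {α τ : ℝ} :
    ∫⁻ t in Ioo α (α + τ), ‖u (w + t • e)‖ₑ ^ 2
      ≤ 2 * ENNReal.ofReal τ * ‖u (w + α • e)‖ₑ ^ 2
        + 2 * ENNReal.ofReal τ ^ 2 * ∫⁻ s in Ioo α (α + τ), ‖fderiv ℝ u (w + s • e)‖ₑ ^ 2 := by
  refine (setLIntegral_mono measurable_const fun t ht => enorm_sq_le_along he hu w ht).trans ?_
  rw [setLIntegral_const, Real.volume_Ioo, add_sub_cancel_left]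
  exact le_of_eq (by ring)

/-- `N` is a collar of height `ρ` above a piece of the graph. On each vertical line `u` is bounded
by its value on the graph and its derivative; integrating over the base turns the first into a
surface integral over `Γ` and the second into a gradient integral over `N`. -/
theorem IsGraphChart.exists_controlled {Ω : Set (E d)} {e : E d} {γ : E d → ℝ} {U : Set (E d)}
    (h : IsGraphChart Ω e γ U) (hΩ : IsOpen Ω) {x : E d} (hxU : x ∈ U) (hx : x ∈ frontier Ω)
    {Γ U' : Set (E d)} (hU' : IsOpen U') (hxU' : x ∈ U') (hΓ : U' ∩ frontier Ω ⊆ Γ) :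
    ∃ N : Set (E d), IsOpen N ∧ N.Nonempty ∧ N ⊆ Ω ∧
      Controlled Ω ((Measure.hausdorffMeasure ((d : ℝ) - 1)).restrict Γ) N := by
  have he := h.norm_eq_one
  have hγ := h.continuous
  obtain ⟨⟨w₀, t₀⟩, hw₀⟩ : ∃ z, graphCoord e he z = x := (graphCoord e he).surjective x
  have hwp : ∀ (w : Hyper e) (t : ℝ),
      ((w : E d) + t • e) - inner ℝ e ((w : E d) + t • e) • e = w := fun w t => by
    rw [sub_inner_add_smul he, inner_hyper, zero_smul, sub_zero]
  have hwi : ∀ (w : Hyper e) (t : ℝ), inner ℝ e ((w : E d) + t • e) = t := fun w t => by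
    rw [inner_add_smul_self he, inner_hyper, zero_add]
  rw [graphCoord_apply] at hw₀
  have ht₀ : γ w₀ = t₀ := by
    have h1 := h.eq_of_mem_frontier hΩ hxU hx
    rwa [← hw₀, hwp, hwi] at h1
  -- The second coordinate is the height above the graph, so a product ball around `(w₀, 0)` is a
  -- straightened neighbourhood of `x`.
  have hopen : IsOpen {z : Hyper e × ℝ | (z.1 : E d) + (γ z.1 + z.2) • e ∈ U ∩ U'} :=
    (h.isOpen.inter hU').preimage (by fun_prop)
  obtain ⟨ρ, hρ, hρU⟩ := Metric.isOpen_iff.1 hopen (w₀, 0) (by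
    simp only [mem_ofPred_eq, add_zero, ht₀, hw₀]
    exact ⟨hxU, hxU'⟩)
  have hmemU : ∀ w ∈ Metric.ball w₀ ρ, ∀ t ∈ Ico 0 ρ, (w : E d) + (γ w + t) • e ∈ U ∩ U' := by
    intro w hw t ht
    refine hρU (a := (w, t)) ?_
    rw [Metric.mem_ball, Prod.dist_eq]
    refine max_lt hw ?_
    rw [Real.dist_eq, sub_zero, abs_of_nonneg ht.1]
    exact ht.2
  have hmemΩ : ∀ w ∈ Metric.ball w₀ ρ, ∀ t ∈ Ioo 0 ρ, (w : E d) + (γ w + t) • e ∈ Ω := by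
    intro w hw t ht
    rw [h.mem_iff _ (hmemU w hw t ⟨ht.1.le, ht.2⟩).1, hwp, hwi]
    linarith [ht.1]
  have hfront : ∀ w ∈ Metric.ball w₀ ρ,
      (w : E d) + γ w • e ∈ (U ∩ U') ∩ frontier Ω := by
    intro w hw
    have h0 : (w : E d) + γ w • e ∈ U ∩ U' := by simpa using hmemU w hw 0 ⟨le_rfl, hρ⟩
    refine ⟨h0, ?_⟩
    rw [hΩ.frontier_eq]
    constructor
    · have ht : Tendsto (fun t : ℝ => (w : E d) + (γ w + t) • e) (𝓝[>] 0)
          (𝓝 ((w : E d) + (γ w + 0) • e)) :=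
        (Continuous.tendsto (by fun_prop) _).mono_left nhdsWithin_le_nhds
      rw [add_zero] at ht
      refine mem_closure_of_tendsto ht ?_
      filter_upwards [Ioo_mem_nhdsGT hρ] with t ht using hmemΩ w hw t ht
    · rw [h.mem_iff _ h0.1, hwp, hwi]
      exact lt_irrefl _
  set pr : E d → Hyper e := fun y => ((graphCoord e he).symm y).1 with hpr
  have hprc : Continuous pr := (lipschitzWith_graphCoord_symm_fst e he).continuous
  have hprw : ∀ (w : Hyper e) (t : ℝ), pr ((w : E d) + t • e) = w := fun w t => by
    ext1; exact hwp w t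
  set N : Set (E d) := pr ⁻¹' Metric.ball w₀ ρ ∩
    {y | γ (pr y) < inner ℝ e y ∧ inner ℝ e y < γ (pr y) + ρ} with hN
  have hmemN : ∀ (w : Hyper e) (t : ℝ), (w : E d) + t • e ∈ N ↔
      w ∈ Metric.ball w₀ ρ ∧ t ∈ Ioo (γ w) (γ w + ρ) := fun w t => by
    simp only [hN, mem_inter_iff, mem_preimage, mem_ofPred_eq, hprw, hwi, mem_Ioo]
  have hNo : IsOpen N := (Metric.isOpen_ball.preimage hprc).inter
    ((isOpen_lt (by fun_prop) (by fun_prop)).and (isOpen_lt (by fun_prop) (by fun_prop)))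
  have hNΩ : N ⊆ Ω := by
    intro y hy
    obtain ⟨⟨w, t⟩, rfl⟩ := (graphCoord e he).surjective y
    rw [graphCoord_apply] at hy ⊢
    rw [hmemN] at hy
    have := hmemΩ w hy.1 (t - γ w) ⟨by linarith [hy.2.1], by linarith [hy.2.2]⟩
    rwa [add_sub_cancel] at this
  refine ⟨N, hNo, ⟨(w₀ : E d) + (γ w₀ + ρ / 2) • e, (hmemN _ _).2 ⟨Metric.mem_ball_self hρ, ?_⟩⟩,
    hNΩ, ?_⟩
  · constructor <;> linarith
  obtain ⟨c, hc⟩ := exists_lintegral_eq_graphCoord e he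
  have hNint : ∀ F : E d → ℝ≥0∞, Measurable F → ∫⁻ x in N, F x =
      c * ∫⁻ w in Metric.ball w₀ ρ, ∫⁻ t in Ioo (γ w) (γ w + ρ), F ((w : E d) + t • e)
        ∂volume ∂(hyperMeasure e) := by
    intro F hF
    rw [← lintegral_indicator hNo.measurableSet, hc _ (hF.indicator hNo.measurableSet),
      ← lintegral_indicator measurableSet_ball]
    congr 1
    refine lintegral_congr fun w => ?_
    by_cases hw : w ∈ Metric.ball w₀ ρ
    · rw [indicator_of_mem hw, ← lintegral_indicator measurableSet_Ioo]
      refine lintegral_congr fun t => ?_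
      by_cases ht : t ∈ Ioo (γ w) (γ w + ρ)
      · rw [indicator_of_mem ht, indicator_of_mem ((hmemN w t).2 ⟨hw, ht⟩)]
      · rw [indicator_of_notMem ht, indicator_of_notMem fun hh => ht ((hmemN w t).1 hh).2]
    · rw [indicator_of_notMem hw, ← lintegral_zero (μ := (volume : Measure ℝ))]
      refine lintegral_congr fun t => ?_
      rw [indicator_of_notMem fun hh => hw ((hmemN w t).1 hh).1]
  -- The first summand comes from the trace term. The second comes from the gradient term, whose
  -- factor `c` is absorbed on returning to an integral over `N`.
  refine ⟨c * (2 * ρ.toNNReal) + 2 * ρ.toNNReal ^ 2, fun u hu => ?_⟩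
  have hum : Measurable fun x => ‖u x‖ₑ ^ 2 := hu.continuous.enorm.measurable.pow_const 2
  have hdm : Measurable fun x => ‖fderiv ℝ u x‖ₑ ^ 2 :=
    (hu.continuous_fderiv (by simp)).enorm.measurable.pow_const 2
  have hgraph := lintegral_graph_le he hγ
    ((h.isOpen.inter hU').measurableSet.inter isClosed_frontier.measurableSet)
    (fun y hy => hΓ ⟨hy.1.2, hy.2⟩) hfront
    (fun y hy => h.eq_of_mem_frontier hΩ hy.1.1 hy.2) hum
  have hum' : Measurable fun w : Hyper e => ‖u ((w : E d) + γ w • e)‖ₑ ^ 2 :=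
    hum.comp (Continuous.measurable (by fun_prop))
  calc ∫⁻ x in N, ‖u x‖ₑ ^ 2
      = c * ∫⁻ w in Metric.ball w₀ ρ, ∫⁻ t in Ioo (γ w) (γ w + ρ), ‖u ((w : E d) + t • e)‖ₑ ^ 2
        ∂volume ∂(hyperMeasure e) := hNint _ hum
    _ ≤ c * ∫⁻ w in Metric.ball w₀ ρ, (2 * ENNReal.ofReal ρ * ‖u ((w : E d) + γ w • e)‖ₑ ^ 2
        + 2 * ENNReal.ofReal ρ ^ 2 * ∫⁻ s in Ioo (γ w) (γ w + ρ),
          ‖fderiv ℝ u ((w : E d) + s • e)‖ₑ ^ 2) ∂(hyperMeasure e) := by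
        gcongr with w
        exact setLIntegral_along_le he hu _
    _ = c * (2 * ENNReal.ofReal ρ)
          * ∫⁻ w in Metric.ball w₀ ρ, ‖u ((w : E d) + γ w • e)‖ₑ ^ 2 ∂(hyperMeasure e)
        + 2 * ENNReal.ofReal ρ ^ 2 * ∫⁻ x in N, ‖fderiv ℝ u x‖ₑ ^ 2 := by
        rw [lintegral_add_left (hum'.const_mul _), lintegral_const_mul' _ _ (by finiteness),
          lintegral_const_mul' _ _ (by finiteness), hNint _ hdm]
        ring
    _ ≤ _ := by
        rw [ENNReal.coe_add, add_mul]
        push_cast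
        refine add_le_add ?_ ?_
        · gcongr
          · exact le_rfl
          · exact hgraph.trans le_add_self
        · gcongr
          · exact le_rfl
          · exact (lintegral_mono_set hNΩ).trans le_self_add

/-- The Poincaré–Friedrichs inequality for smooth functions: it suffices to control the trace on
a set with nonempty interior in the boundary. -/
theorem IsBoundedLipschitzDomain.controlled_of_interior {Ω Γ : Set (E d)}
    (hΩ : IsBoundedLipschitzDomain Ω)
    (hΓ : ∃ U : Set (E d), IsOpen U ∧ (U ∩ frontier Ω).Nonempty ∧ U ∩ frontier Ω ⊆ Γ) :
    Controlled Ω ((Measure.hausdorffMeasure ((d : ℝ) - 1)).restrict Γ) Ω := by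
  obtain ⟨U', hU', ⟨x, hxU', hx⟩, hsub⟩ := hΓ
  obtain ⟨e, K, γ, U, he, hγ, hU, hxU, hy⟩ := hΩ.lipschitz_boundary x hx
  have hchart : IsGraphChart Ω e γ U := ⟨he, hγ.continuous, hU, hy⟩
  obtain ⟨N, hN, hNne, hNΩ, hNc⟩ := hchart.exists_controlled hΩ.isOpen hxU hx hU' hxU' hsub
  exact hΩ.controlled hN hNne hNΩ hNc

/-! ### `H¹(Ω)` and its closed subspaces -/

/-- The inclusion `H¹(Ω) → L²(Ω)` as a continuous linear map. -/
noncomputable def valL (Ω : Set (E d)) : H1 Ω →L[ℝ] L2 Ω :=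
  WithLp.fstL 2 ℝ (L2 Ω) (L2vec Ω) ∘L (H1 Ω).subtypeL

/-- The gradient `H¹(Ω) → L²(Ω)^d` as a continuous linear map. -/
noncomputable def gradL (Ω : Set (E d)) : H1 Ω →L[ℝ] L2vec Ω :=
  WithLp.sndL 2 ℝ (L2 Ω) (L2vec Ω) ∘L (H1 Ω).subtypeL

@[simp] theorem gradL_apply {Ω : Set (E d)} (φ : H1 Ω) : gradL Ω φ = grad φ := rfl

theorem norm_sq_eq {Ω : Set (E d)} (φ : H1 Ω) : ‖φ‖ ^ 2 = ‖val φ‖ ^ 2 + ‖grad φ‖ ^ 2 :=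
  WithLp.prod_norm_sq_eq_of_L2 (φ : WithLp 2 (L2 Ω × L2vec Ω))

theorem norm_val_le {Ω : Set (E d)} (φ : H1 Ω) : ‖val φ‖ ≤ ‖φ‖ :=
  le_of_sq_le_sq (by rw [norm_sq_eq]; nlinarith [sq_nonneg ‖grad φ‖]) (norm_nonneg _)

/-- For a fixed test function and direction, both sides of the weak-gradient identity are `L²` inner
products with fixed elements, so each condition is closed. -/
theorem isClosed_H1 (Ω : Set (E d)) : IsClosed (H1 Ω : Set (WithLp 2 (L2 Ω × L2vec Ω))) := by
  have h : (H1 Ω : Set (WithLp 2 (L2 Ω × L2vec Ω))) =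
      ⋂ (ψ : E d → ℝ) (_ : ContDiff ℝ ∞ ψ) (_ : HasCompactSupport ψ) (_ : tsupport ψ ⊆ Ω)
        (v : E d), {w | ∫ x in Ω, w.fst x * fderiv ℝ ψ x v
          = - ∫ x in Ω, inner ℝ (w.snd x) v * ψ x} := by
    ext w
    simp only [mem_iInter]
    rfl
  rw [h]
  refine isClosed_iInter fun ψ => isClosed_iInter fun hψ => isClosed_iInter fun hc =>
    isClosed_iInter fun _ => isClosed_iInter fun v => ?_
  have hD : MemLp (fun x => fderiv ℝ ψ x v) 2 (volume.restrict Ω) :=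
    Continuous.memLp_of_hasCompactSupport
      ((hψ.continuous_fderiv (by simp)).clm_apply continuous_const) (hc.fderiv_apply (𝕜 := ℝ) v)
  have hV : MemLp (fun x => ψ x • v) 2 (volume.restrict Ω) :=
    Continuous.memLp_of_hasCompactSupport (hψ.continuous.smul continuous_const) hc.smul_right
  have h1 : ∀ u : L2 Ω, ∫ x in Ω, u x * fderiv ℝ ψ x v = inner ℝ (hD.toLp _) u := fun u => by
    rw [L2.inner_def]
    refine integral_congr_ae ?_
    filter_upwards [hD.coeFn_toLp] with x hx
    rw [hx]
    simp
  have h2 : ∀ g : L2vec Ω, ∫ x in Ω, inner ℝ (g x) v * ψ x = inner ℝ (hV.toLp _) g := fun g => by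
    rw [L2.inner_def]
    refine integral_congr_ae ?_
    filter_upwards [hV.coeFn_toLp] with x hx
    rw [hx, real_inner_smul_left, real_inner_comm, mul_comm]
  simp only [h1, h2]
  have hf : Continuous fun w : WithLp 2 (L2 Ω × L2vec Ω) => w.fst :=
    (WithLp.fstL 2 ℝ (L2 Ω) (L2vec Ω)).continuous
  have hs : Continuous fun w : WithLp 2 (L2 Ω × L2vec Ω) => w.snd :=
    (WithLp.sndL 2 ℝ (L2 Ω) (L2vec Ω)).continuous
  exact isClosed_eq (continuous_const.inner hf) (continuous_const.inner hs).neg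

instance completeSpace_H1 (Ω : Set (E d)) : CompleteSpace (H1 Ω) :=
  (isClosed_H1 Ω).completeSpace_coe

theorem tendsto_eLpNorm_sub_of_tendsto {F : Type*} [NormedAddCommGroup F] {Ω : Set (E d)}
    {f : ℕ → Lp F 2 (volume.restrict Ω)} {g : Lp F 2 (volume.restrict Ω)}
    (h : Tendsto f atTop (𝓝 g)) :
    Tendsto (fun k => eLpNorm (fun x => f k x - g x) 2 (volume.restrict Ω)) atTop (𝓝 0) :=
  (Lp.tendsto_Lp_iff_tendsto_eLpNorm' f g).1 h

/-- A diagonal choice: the `k`-th approximant is taken within `1/k` of the `k`-th term,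
simultaneously for the function, the gradient and the trace. -/
theorem isClosed_spaceV (Ω : Set (E d)) (b : E d → E d) : IsClosed (spaceV Ω b : Set (H1 Ω)) := by
  refine isClosed_of_closure_subset fun φ hφ => ?_
  obtain ⟨s, hs, hsφ⟩ := mem_closure_iff_seq_limit.1 hφ
  -- At `k = 0` the inverse is `∞`, so the requirement there is vacuous.
  have hpos : ∀ k : ℕ, (0 : ℝ≥0∞) < (k : ℝ≥0∞)⁻¹ := fun k => by simp
  have hinv : Tendsto (fun k : ℕ => (k : ℝ≥0∞)⁻¹) atTop (𝓝 0) :=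
    ENNReal.tendsto_inv_nat_nhds_zero
  have hex : ∀ k : ℕ, ∃ w : E d → ℝ, ContDiff ℝ ∞ w ∧
      eLpNorm (fun x => w x - val (s k) x) 2 (volume.restrict Ω) ≤ (k : ℝ≥0∞)⁻¹ ∧
      eLpNorm (fun x => gradient w x - grad (s k) x) 2 (volume.restrict Ω) ≤ (k : ℝ≥0∞)⁻¹ ∧
      eLpNorm (fun x => w x - (0 : E d → ℝ) x) 2
        ((Measure.hausdorffMeasure ((d : ℝ) - 1)).restrict (dirichletBoundary Ω b))
        ≤ (k : ℝ≥0∞)⁻¹ := by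
    intro k
    obtain ⟨u, hu, h1, h2, h3⟩ := hs k
    obtain ⟨n, h1, h2, h3⟩ := ((ENNReal.tendsto_nhds_zero.1 h1 _ (hpos k)).and
      ((ENNReal.tendsto_nhds_zero.1 h2 _ (hpos k)).and
        (ENNReal.tendsto_nhds_zero.1 h3 _ (hpos k)))).exists
    exact ⟨u n, hu n, h1, h2, h3⟩
  choose w hw h1 h2 h3 using hex
  have hle : ∀ {a : ℕ → ℝ≥0∞}, (∀ k, a k ≤ (k : ℝ≥0∞)⁻¹) → Tendsto a atTop (𝓝 0) := fun h =>
    tendsto_of_tendsto_of_tendsto_of_le_of_le tendsto_const_nhds hinv (fun _ => bot_le) h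
  refine ⟨w, hw, ?_, ?_, hle h3⟩
  · refine tendsto_eLpNorm_add
      (fun k => (hw k).continuous.aestronglyMeasurable.sub (Lp.aestronglyMeasurable (val (s k))))
      (fun k => (Lp.aestronglyMeasurable (val (s k))).sub (Lp.aestronglyMeasurable (val φ)))
      (hle h1) (tendsto_eLpNorm_sub_of_tendsto (((valL Ω).continuous.tendsto φ).comp hsφ))
      (fun k => Eventually.of_forall fun x => ?_)
    simp
  · refine tendsto_eLpNorm_add
      (fun k => (continuous_gradient (hw k)).aestronglyMeasurable.sub
        (Lp.aestronglyMeasurable (grad (s k))))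
      (fun k => (Lp.aestronglyMeasurable (grad (s k))).sub (Lp.aestronglyMeasurable (grad φ)))
      (hle h2) (tendsto_eLpNorm_sub_of_tendsto (((gradL Ω).continuous.tendsto φ).comp hsφ))
      (fun k => Eventually.of_forall fun x => ?_)
    simp

instance completeSpace_spaceV (Ω : Set (E d)) (b : E d → E d) : CompleteSpace (spaceV Ω b) :=
  (isClosed_spaceV Ω b).completeSpace_coe

theorem eLpNorm_two_sq {α F : Type*} [MeasurableSpace α] [NormedAddCommGroup F] {μ : Measure α}
    (f : α → F) : eLpNorm f 2 μ ^ 2 = ∫⁻ x, ‖f x‖ₑ ^ 2 ∂μ := by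
  have := eLpNorm_nnreal_pow_eq_lintegral (f := f) (μ := μ) (p := 2) (by norm_num)
  simpa using this

theorem enorm_gradient (u : E d → ℝ) (x : E d) : ‖gradient u x‖ₑ = ‖fderiv ℝ u x‖ₑ := by
  rw [← ofReal_norm, ← ofReal_norm, gradient, LinearIsometryEquiv.norm_map]

theorem Controlled.eLpNorm_le {Ω W : Set (E d)} {μ : Measure (E d)} (h : Controlled Ω μ W) :
    ∃ C : ℝ≥0, ∀ u : E d → ℝ, ContDiff ℝ ∞ u → eLpNorm u 2 (volume.restrict W)
      ≤ C * (eLpNorm (gradient u) 2 (volume.restrict Ω) + eLpNorm u 2 μ) := by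
  obtain ⟨C, hC⟩ := h
  -- `C ≤ (C + 1) ^ 2`, which avoids taking a square root of `C`.
  refine ⟨C + 1, fun u hu => ?_⟩
  rw [← ENNReal.pow_le_pow_left_iff two_ne_zero, mul_pow]
  have h1 := hC u hu
  simp only [← enorm_gradient, ← eLpNorm_two_sq] at h1
  refine h1.trans (mul_le_mul' ?_ ?_)
  · norm_cast
    nlinarith [(zero_le : 0 ≤ C)]
  · rw [add_sq]
    calc _ ≤ eLpNorm (gradient u) 2 (volume.restrict Ω) ^ 2 + eLpNorm u 2 μ ^ 2
        + 2 * eLpNorm (gradient u) 2 (volume.restrict Ω) * eLpNorm u 2 μ := le_self_add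
      _ = _ := by ring

/-- The Poincaré–Friedrichs inequality on `𝒱`. -/
theorem exists_norm_val_le_norm_grad {Ω : Set (E d)} {b : E d → E d}
    (hΩ : IsBoundedLipschitzDomain Ω)
    (hΓ : ∃ U : Set (E d), IsOpen U ∧ (U ∩ frontier Ω).Nonempty ∧
      U ∩ frontier Ω ⊆ dirichletBoundary Ω b) :
    ∃ C : ℝ, 0 ≤ C ∧ ∀ φ ∈ spaceV Ω b, ‖val φ‖ ≤ C * ‖grad φ‖ := by
  obtain ⟨C, hC⟩ := (hΩ.controlled_of_interior hΓ).eLpNorm_le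
  refine ⟨C, C.2, fun φ hφ => ?_⟩
  obtain ⟨u, hu, h1, h2, h3⟩ := hφ
  -- The smooth inequality applied to the approximants; every term except the gradient of `φ`
  -- vanishes in the limit.
  have hbound : ∀ k, eLpNorm (val φ) 2 (volume.restrict Ω) ≤
      eLpNorm (fun x => u k x - val φ x) 2 (volume.restrict Ω)
      + C * (eLpNorm (fun x => gradient (u k) x - grad φ x) 2 (volume.restrict Ω)
        + eLpNorm (grad φ) 2 (volume.restrict Ω)
        + eLpNorm (fun x => u k x - (0 : E d → ℝ) x) 2
          ((Measure.hausdorffMeasure ((d : ℝ) - 1)).restrict (dirichletBoundary Ω b))) := by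
    intro k
    have hum : AEStronglyMeasurable (u k) (volume.restrict Ω) :=
      (hu k).continuous.aestronglyMeasurable
    have hgm : AEStronglyMeasurable (gradient (u k)) (volume.restrict Ω) :=
      (continuous_gradient (hu k)).aestronglyMeasurable
    have e1 : eLpNorm (val φ) 2 (volume.restrict Ω)
        ≤ eLpNorm (u k - ⇑(val φ)) 2 (volume.restrict Ω) + eLpNorm (u k) 2 (volume.restrict Ω) := by
      rw [eLpNorm_sub_comm]
      calc eLpNorm (val φ) 2 (volume.restrict Ω)
          = eLpNorm ((⇑(val φ) - u k) + u k) 2 (volume.restrict Ω) := by rw [sub_add_cancel]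
        _ ≤ _ := eLpNorm_add_le ((Lp.aestronglyMeasurable _).sub hum) hum (by norm_num)
    have e2 : eLpNorm (gradient (u k)) 2 (volume.restrict Ω)
        ≤ eLpNorm (gradient (u k) - ⇑(grad φ)) 2 (volume.restrict Ω)
          + eLpNorm (grad φ) 2 (volume.restrict Ω) := by
      calc eLpNorm (gradient (u k)) 2 (volume.restrict Ω)
          = eLpNorm ((gradient (u k) - ⇑(grad φ)) + ⇑(grad φ)) 2 (volume.restrict Ω) := by
            rw [sub_add_cancel]
        _ ≤ _ := eLpNorm_add_le (hgm.sub (Lp.aestronglyMeasurable _))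
          (Lp.aestronglyMeasurable _) (by norm_num)
    refine e1.trans (add_le_add le_rfl ((hC (u k) (hu k)).trans (mul_le_mul' le_rfl ?_)))
    refine add_le_add e2 (le_of_eq ?_)
    simp
  have hlim : Tendsto (fun k => eLpNorm (fun x => u k x - val φ x) 2 (volume.restrict Ω)
      + C * (eLpNorm (fun x => gradient (u k) x - grad φ x) 2 (volume.restrict Ω)
        + eLpNorm (grad φ) 2 (volume.restrict Ω)
        + eLpNorm (fun x => u k x - (0 : E d → ℝ) x) 2
          ((Measure.hausdorffMeasure ((d : ℝ) - 1)).restrict (dirichletBoundary Ω b)))) atTop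
      (𝓝 (0 + C * (0 + eLpNorm (grad φ) 2 (volume.restrict Ω) + 0))) :=
    h1.add (ENNReal.Tendsto.const_mul ((h2.add tendsto_const_nhds).add h3)
      (Or.inr ENNReal.coe_ne_top))
  have h := ge_of_tendsto' hlim hbound
  rw [zero_add, zero_add, add_zero] at h
  rw [Lp.norm_def, Lp.norm_def]
  have h' := ENNReal.toReal_mono
    (ENNReal.mul_ne_top ENNReal.coe_ne_top (Lp.eLpNorm_ne_top (grad φ))) h
  rwa [ENNReal.toReal_mul, ENNReal.coe_toReal] at h'

/-- An element of `H¹(Ω)` is determined by its values. -/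
theorem eq_zero_of_val_eq_zero {Ω : Set (E d)} (hΩ : IsOpen Ω) {φ : H1 Ω} (hφ : val φ = 0) :
    φ = 0 := by
  have hg : grad φ = 0 := by
    have hloc : LocallyIntegrable (grad φ) (volume.restrict Ω) :=
      (Lp.memLp (grad φ)).locallyIntegrable (by norm_num)
    -- Fundamental lemma of the calculus of variations: a weak gradient of zero integrates to zero
    -- against every test function.
    have key : ∀ᵐ x ∂(volume.restrict Ω), x ∈ Ω → grad φ x = 0 := by
      refine hΩ.ae_eq_zero_of_integral_contDiff_smul_eq_zero (hloc.locallyIntegrableOn Ω)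
        fun ψ hψ hc hs => ?_
      have hint : Integrable (fun x => ψ x • grad φ x) (volume.restrict Ω) :=
        hloc.integrable_smul_left_of_hasCompactSupport hψ.continuous hc
      refine ext_inner_right ℝ fun v => ?_
      rw [inner_zero_left, real_inner_comm, ← integral_inner hint]
      have h1 := φ.2 ψ hψ hc hs v
      have h2 : ∫ x in Ω, val φ x * fderiv ℝ ψ x v = 0 := by
        rw [← integral_zero (E d) ℝ (μ := volume.restrict Ω)]
        refine integral_congr_ae ?_
        filter_upwards [Lp.coeFn_zero ℝ 2 (volume.restrict Ω)] with x hx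
        rw [hφ, hx, Pi.zero_apply, zero_mul]
      change ∫ x in Ω, val φ x * fderiv ℝ ψ x v = - ∫ x in Ω, inner ℝ (grad φ x) v * ψ x at h1
      rw [h2, eq_comm, neg_eq_zero] at h1
      rw [← h1]
      refine integral_congr_ae (Eventually.of_forall fun x => ?_)
      simp only [inner_smul_right, real_inner_comm v, mul_comm]
    refine Lp.ext ?_
    filter_upwards [key, ae_restrict_mem hΩ.measurableSet, Lp.coeFn_zero (E d) 2
      (volume.restrict Ω)] with x h1 h2 h3
    rw [h1 h2, h3, Pi.zero_apply]
  rw [← norm_eq_zero, ← sq_eq_zero_iff, norm_sq_eq, hφ, hg]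
  simp

/-! ### Singularly perturbed coercive problems in Hilbert space -/

section Abstract

variable {V X : Type*} [NormedAddCommGroup V] [InnerProductSpace ℝ V]
  [NormedAddCommGroup X] [InnerProductSpace ℝ X]

theorem existsUnique_laxMilgram [CompleteSpace V] {B : V →L[ℝ] V →L[ℝ] ℝ} (hB : IsCoercive B)
    (ℓ : V →L[ℝ] ℝ) :
    ∃! φ, ∀ ψ, B φ ψ = ℓ ψ := by
  refine ⟨hB.continuousLinearEquivOfBilin.symm ((InnerProductSpace.toDual ℝ V).symm ℓ),
    fun ψ => ?_, fun φ hφ => ?_⟩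
  · rw [← hB.continuousLinearEquivOfBilin_apply, ContinuousLinearEquiv.apply_symm_apply,
      InnerProductSpace.toDual_symm_apply]
  · rw [ContinuousLinearEquiv.eq_symm_apply]
    refine ext_inner_right ℝ fun ψ => ?_
    rw [hB.continuousLinearEquivOfBilin_apply, InnerProductSpace.toDual_symm_apply, hφ ψ]

/-- The bilinear form `(φ, ψ) ↦ ⟪T R φ, R ψ⟫`. -/
noncomputable def quadForm (T : X →L[ℝ] X) (R : V →L[ℝ] X) : V →L[ℝ] V →L[ℝ] ℝ :=
  (innerSL ℝ).bilinearComp (T ∘L R) R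

/-- The orthogonal complement of `ker R` is the closure of the range of the adjoint. Approximating
`m` by `R* y` leaves `⟪y, R (e i)⟫`, which tends to zero, and an error controlled by the bound on
`e`. -/
theorem tendsto_inner_of_mem_orthogonal_ker [CompleteSpace V] [CompleteSpace X]
    {ι : Type*} {F : Filter ι}
    (R : V →L[ℝ] X) {m : V} (hm : ∀ ψ, R ψ = 0 → inner ℝ m ψ = 0) {e : ι → V} {M : ℝ}
    (hM : ∀ᶠ i in F, ‖e i‖ ≤ M) (hR : Tendsto (fun i => ‖R (e i)‖) F (𝓝 0)) :
    Tendsto (fun i => inner ℝ m (e i)) F (𝓝 0) := by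
  have hm' : m ∈ closure (Set.range (ContinuousLinearMap.adjoint R)) := by
    have h1 : m ∈ (R : V →ₗ[ℝ] X).kerᗮ := by
      rw [Submodule.mem_orthogonal']
      exact fun ψ hψ => hm ψ hψ
    rw [ContinuousLinearMap.orthogonal_ker] at h1
    exact h1
  rw [Metric.tendsto_nhds]
  intro η hη
  set δ : ℝ := η / (2 * (|M| + 1)) with hδ
  have hδ0 : 0 < δ := by positivity
  obtain ⟨_, ⟨y, rfl⟩, hy⟩ := Metric.mem_closure_iff.1 hm' δ hδ0
  rw [dist_eq_norm] at hy
  have hy0 : Tendsto (fun i => ‖y‖ * ‖R (e i)‖) F (𝓝 0) := by simpa using hR.const_mul ‖y‖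
  filter_upwards [hM, hy0.eventually (gt_mem_nhds (half_pos hη))] with i hi1 hi2
  rw [dist_zero_right, Real.norm_eq_abs]
  have hsplit : inner ℝ m (e i) = inner ℝ (m - ContinuousLinearMap.adjoint R y) (e i)
      + inner ℝ y (R (e i)) := by
    rw [inner_sub_left, ContinuousLinearMap.adjoint_inner_left, sub_add_cancel]
  have h1 : ‖m - ContinuousLinearMap.adjoint R y‖ * ‖e i‖ ≤ η / 2 := by
    calc ‖m - ContinuousLinearMap.adjoint R y‖ * ‖e i‖ ≤ δ * (|M| + 1) := by
          gcongr
          exact hi1.trans ((le_abs_self M).trans (by linarith))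
      _ = η / 2 := by rw [hδ]; field_simp
  calc |inner ℝ m (e i)| ≤ ‖m - ContinuousLinearMap.adjoint R y‖ * ‖e i‖ + ‖y‖ * ‖R (e i)‖ := by
        rw [hsplit]
        exact (abs_add_le _ _).trans
          (add_le_add (abs_real_inner_le_norm _ _) (abs_real_inner_le_norm _ _))
    _ < η := by linarith

/-- Coercivity of the two parts of a singularly perturbed form. -/
structure IsSplitCoercive (T T' : X →L[ℝ] X) (R S : V →L[ℝ] X) (α c : ℝ) : Prop where
  pos_left : 0 < α
  pos_right : 0 < c
  le_par : ∀ φ, α * ‖R φ‖ ^ 2 ≤ inner ℝ (T (R φ)) (R φ)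
  le_perp : ∀ φ, α * ‖S φ‖ ^ 2 ≤ inner ℝ (T' (S φ)) (S φ)
  le_norm : ∀ φ, c * ‖φ‖ ^ 2 ≤ ‖R φ‖ ^ 2 + ‖S φ‖ ^ 2

namespace IsSplitCoercive

variable {T T' : X →L[ℝ] X} {R S : V →L[ℝ] X} {α c : ℝ}

theorem existsUnique_perturbed [CompleteSpace V] (h : IsSplitCoercive T T' R S α c)
    (ℓ : V →L[ℝ] ℝ) {ε : ℝ} (hε : 0 < ε) :
    ∃! φ, ∀ ψ, inner ℝ (T (R φ)) (R ψ) + ε * inner ℝ (T' (S φ)) (S ψ) = ε * ℓ ψ := by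
  have hα := h.pos_left
  have hc := h.pos_right
  have hcoer : IsCoercive (quadForm T R + ε • quadForm T' S) := by
    -- `min 1 ε` lies below both weights `1` and `ε`, so no upper bound on `ε` is needed here.
    refine ⟨min 1 ε * α * c, by positivity, fun φ => ?_⟩
    change _ ≤ inner ℝ (T (R φ)) (R φ) + ε * inner ℝ (T' (S φ)) (S φ)
    have h1 := h.le_par φ
    have h2 := mul_le_mul_of_nonneg_left (h.le_perp φ) hε.le
    have h3 := mul_le_mul_of_nonneg_left (h.le_norm φ) (by positivity : 0 ≤ min 1 ε * α)
    have h4 : min 1 ε * (α * ‖R φ‖ ^ 2) ≤ 1 * (α * ‖R φ‖ ^ 2) := by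
      gcongr; exact min_le_left _ _
    have h5 : min 1 ε * (α * ‖S φ‖ ^ 2) ≤ ε * (α * ‖S φ‖ ^ 2) := by
      gcongr; exact min_le_right _ _
    nlinarith
  exact existsUnique_laxMilgram hcoer (ε • ℓ)

/-- On `ker R` the form in `S` alone is coercive, so Lax–Milgram applies on that closed subspace. -/
theorem exists_limit [CompleteSpace V] (h : IsSplitCoercive T T' R S α c) (ℓ : V →L[ℝ] ℝ) :
    ∃ φ, R φ = 0 ∧ ∀ ψ, R ψ = 0 → inner ℝ (T' (S φ)) (S ψ) = ℓ ψ := by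
  have hα := h.pos_left
  have hc := h.pos_right
  set G : Submodule ℝ V := (R : V →ₗ[ℝ] X).ker with hG
  have hmem : ∀ φ, φ ∈ G ↔ R φ = 0 := fun φ => Iff.rfl
  have : CompleteSpace G := (ContinuousLinearMap.isClosed_ker R).completeSpace_coe
  have hcoer : IsCoercive (quadForm T' (S ∘L G.subtypeL)) := by
    refine ⟨α * c, by positivity, fun φ => ?_⟩
    change _ ≤ inner ℝ (T' (S (φ : V))) (S (φ : V))
    have h1 := h.le_perp φ
    have h3 := mul_le_mul_of_nonneg_left (h.le_norm φ) hα.le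
    rw [(hmem _).1 φ.2, norm_zero] at h3
    rw [Submodule.coe_norm]
    nlinarith
  obtain ⟨φ, hφ, -⟩ := existsUnique_laxMilgram hcoer (ℓ ∘L G.subtypeL)
  exact ⟨φ, φ.2, fun ψ hψ => hφ ⟨ψ, hψ⟩⟩

theorem eq_of_limit (h : IsSplitCoercive T T' R S α c) {ℓ : V →L[ℝ] ℝ} {φ φ' : V}
    (hR : R φ = 0) (hφ : ∀ ψ, R ψ = 0 → inner ℝ (T' (S φ)) (S ψ) = ℓ ψ)
    (hR' : R φ' = 0) (hφ' : ∀ ψ, R ψ = 0 → inner ℝ (T' (S φ')) (S ψ) = ℓ ψ) : φ' = φ := by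
  have hα := h.pos_left
  have hc := h.pos_right
  have h0 : R (φ' - φ) = 0 := by rw [map_sub, hR, hR', sub_zero]
  have h1 := h.le_perp (φ' - φ)
  have h2 := h.le_norm (φ' - φ)
  have h3 : inner ℝ (T' (S (φ' - φ))) (S (φ' - φ)) = 0 := by
    rw [map_sub S φ' φ, map_sub, inner_sub_left, ← map_sub S φ' φ, hφ' _ h0, hφ _ h0, sub_self]
  rw [h3] at h1
  rw [h0, norm_zero] at h2
  have h4 : ‖S (φ' - φ)‖ ^ 2 ≤ 0 := by
    by_contra! hlt; nlinarith [mul_pos hα hlt]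
  have h5 : ‖φ' - φ‖ ^ 2 ≤ 0 := by
    by_contra! hlt; nlinarith [mul_pos hc hlt]
  have h6 : ‖φ' - φ‖ = 0 := by nlinarith [norm_nonneg (φ' - φ)]
  exact sub_eq_zero.1 (norm_eq_zero.1 h6)

/-- For `ε < 1` the parallel part may be weakened by the factor `ε`. The common factor then cancels
against the right-hand side of (P), which makes the estimates uniform. -/
theorem le_form (h : IsSplitCoercive T T' R S α c) {ε : ℝ} (hε : 0 < ε) (hε1 : ε < 1) (φ : V) :
    ε * (α * c * ‖φ‖ ^ 2) ≤ inner ℝ (T (R φ)) (R φ) + ε * inner ℝ (T' (S φ)) (S φ) := by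
  have hα := h.pos_left
  have h1 := h.le_par φ
  have h2 := mul_le_mul_of_nonneg_left (h.le_perp φ) hε.le
  have h3 := mul_le_mul_of_nonneg_left (h.le_norm φ) (by positivity : 0 ≤ ε * α)
  have h4 : ε * (α * ‖R φ‖ ^ 2) ≤ 1 * (α * ‖R φ‖ ^ 2) := by gcongr
  nlinarith

theorem norm_le (h : IsSplitCoercive T T' R S α c) {ℓ : V →L[ℝ] ℝ} {ε : ℝ} (hε : 0 < ε)
    (hε1 : ε < 1) {φ : V}
    (hφ : ∀ ψ, inner ℝ (T (R φ)) (R ψ) + ε * inner ℝ (T' (S φ)) (S ψ) = ε * ℓ ψ) :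
    ‖φ‖ ≤ (α * c)⁻¹ * ‖ℓ‖ := by
  have hαc : 0 < α * c := mul_pos h.pos_left h.pos_right
  have h1 := h.le_form hε hε1 φ
  rw [hφ φ] at h1
  have h2 : α * c * ‖φ‖ ^ 2 ≤ ‖ℓ‖ * ‖φ‖ :=
    (le_of_mul_le_mul_left h1 hε).trans ((le_abs_self _).trans (ℓ.le_opNorm φ))
  rw [inv_mul_eq_div, le_div_iff₀ hαc]
  rcases (norm_nonneg φ).eq_or_lt with h0 | h0
  · rw [← h0, zero_mul]; positivity
  · nlinarith

/-- The solutions of the perturbed problems converge strongly to the solution of the limit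
problem. -/
theorem tendsto [CompleteSpace V] [CompleteSpace X] (h : IsSplitCoercive T T' R S α c)
    {ℓ : V →L[ℝ] ℝ} {φ : ℝ → V} {φ₀ : V}
    (hφ : ∀ ε, 0 < ε → ∀ ψ,
      inner ℝ (T (R (φ ε))) (R ψ) + ε * inner ℝ (T' (S (φ ε))) (S ψ) = ε * ℓ ψ)
    (hR : R φ₀ = 0) (hφ₀ : ∀ ψ, R ψ = 0 → inner ℝ (T' (S φ₀)) (S ψ) = ℓ ψ) :
    Tendsto φ (𝓝[>] 0) (𝓝 φ₀) := by
  have hα := h.pos_left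
  have hc := h.pos_right
  have hsmall : ∀ᶠ ε : ℝ in 𝓝[>] 0, 0 < ε ∧ ε < 1 := Ioo_mem_nhdsGT one_pos
  -- The Riesz representative of the residual of the limit problem; it is orthogonal to `ker R` by
  -- `hφ₀`.
  set m : V := (InnerProductSpace.toDual ℝ V).symm (ℓ - quadForm T' S φ₀) with hm
  have hmi : ∀ ψ, inner ℝ m ψ = ℓ ψ - inner ℝ (T' (S φ₀)) (S ψ) := fun ψ => by
    rw [hm, InnerProductSpace.toDual_symm_apply]; rfl
  have hform : ∀ ε, 0 < ε → inner ℝ (T (R (φ ε - φ₀))) (R (φ ε - φ₀))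
      + ε * inner ℝ (T' (S (φ ε - φ₀))) (S (φ ε - φ₀)) = ε * inner ℝ m (φ ε - φ₀) := by
    intro ε hε
    have h1 : R (φ ε - φ₀) = R (φ ε) := by rw [map_sub, hR, sub_zero]
    have h2 : T' (S (φ ε - φ₀)) = T' (S (φ ε)) - T' (S φ₀) := by rw [map_sub, map_sub]
    have h3 := hφ ε hε (φ ε - φ₀)
    rw [h1] at h3
    rw [h1, h2, inner_sub_left, hmi]
    linarith
  set M : ℝ := (α * c)⁻¹ * ‖ℓ‖ + ‖φ₀‖ with hM
  have hbd : ∀ᶠ ε in 𝓝[>] 0, ‖φ ε - φ₀‖ ≤ M := by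
    filter_upwards [hsmall] with ε hε
    exact (norm_sub_le _ _).trans (add_le_add (h.norm_le hε.1 hε.2 (hφ ε hε.1)) le_rfl)
  -- Dropping the nonnegative perpendicular part of `hform` leaves `α ‖R e‖² ≤ ε ‖m‖ M`.
  have hRlim : Tendsto (fun ε => ‖R (φ ε - φ₀)‖) (𝓝[>] 0) (𝓝 0) := by
    have hid : Tendsto (fun ε : ℝ => ε) (𝓝[>] 0) (𝓝 0) := tendsto_id.mono_left nhdsWithin_le_nhds
    have hsq : Tendsto (fun ε => ‖R (φ ε - φ₀)‖ ^ 2) (𝓝[>] 0) (𝓝 0) := by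
      refine squeeze_zero' (g := fun ε => ε * (α⁻¹ * (‖m‖ * M)))
        (Eventually.of_forall fun _ => by positivity) ?_
        (by simpa using hid.mul_const (α⁻¹ * (‖m‖ * M)))
      filter_upwards [hsmall, hbd] with ε hε hb
      have h1 := h.le_par (φ ε - φ₀)
      have h2 : 0 ≤ ε * inner ℝ (T' (S (φ ε - φ₀))) (S (φ ε - φ₀)) :=
        mul_nonneg hε.1.le (le_trans (by positivity) (h.le_perp (φ ε - φ₀)))
      have h3 : inner ℝ m (φ ε - φ₀) ≤ ‖m‖ * M :=
        (real_inner_le_norm _ _).trans (by gcongr)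
      have h4 := mul_le_mul_of_nonneg_left h3 hε.1.le
      have h5 := hform ε hε.1
      rw [mul_left_comm, inv_mul_eq_div, le_div_iff₀ hα]
      linarith
    have := hsq.sqrt
    simpa [Real.sqrt_sq (norm_nonneg _)] using this
  have hmlim : Tendsto (fun ε => inner ℝ m (φ ε - φ₀)) (𝓝[>] 0) (𝓝 0) :=
    tendsto_inner_of_mem_orthogonal_ker R
      (fun ψ hψ => by rw [hmi, hφ₀ ψ hψ, sub_self]) hbd hRlim
  rw [tendsto_iff_norm_sub_tendsto_zero]
  have hsq : Tendsto (fun ε => ‖φ ε - φ₀‖ ^ 2) (𝓝[>] 0) (𝓝 0) := by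
    refine squeeze_zero' (g := fun ε => (α * c)⁻¹ * inner ℝ m (φ ε - φ₀))
      (Eventually.of_forall fun _ => by positivity) ?_
      (by simpa using hmlim.const_mul (α * c)⁻¹)
    filter_upwards [hsmall] with ε hε
    have h1 := h.le_form hε.1 hε.2 (φ ε - φ₀)
    rw [hform ε hε.1] at h1
    rw [inv_mul_eq_div, le_div_iff₀ (mul_pos hα hc), mul_comm]
    exact le_of_mul_le_mul_left h1 hε.1
  have := hsq.sqrt
  simpa [Real.sqrt_sq (norm_nonneg _)] using this

end IsSplitCoercive

end Abstract

/-! ### The bilinear forms as bounded operators -/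

/-- Multiplication by a bounded matrix field is a bounded operator on `L²(Ω)^d`. -/
theorem exists_multiplication {Ω : Set (E d)} {M : E d → E d →L[ℝ] E d}
    (hM : MemLp M ∞ (volume.restrict Ω)) :
    ∃ T : L2vec Ω →L[ℝ] L2vec Ω, ∀ g, T g =ᵐ[volume.restrict Ω] fun x => M x (g x) := by
  refine ⟨(ContinuousLinearMap.id ℝ (E d →L[ℝ] E d)).holderL (volume.restrict Ω) ∞ 2 2
    (hM.toLp M), fun g => ?_⟩
  filter_upwards [hM.coeFn_toLp, ContinuousLinearMap.coeFn_holder (r := 2)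
    (ContinuousLinearMap.id ℝ (E d →L[ℝ] E d)) (hM.toLp M) g] with x h1 h2
  change (ContinuousLinearMap.holder 2 _ _ _ : L2vec Ω) x = _
  rw [h2, h1]
  rfl

theorem mul_norm_sq_le_inner_multiplication {Ω : Set (E d)} {M : E d → E d →L[ℝ] E d}
    {T : L2vec Ω →L[ℝ] L2vec Ω} (hT : ∀ g, T g =ᵐ[volume.restrict Ω] fun x => M x (g x)) {α : ℝ}
    (hα : ∀ᵐ x ∂(volume.restrict Ω), ∀ v, α * ‖v‖ ^ 2 ≤ inner ℝ v (M x v)) (g : L2vec Ω) :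
    α * ‖g‖ ^ 2 ≤ inner ℝ (T g) g := by
  rw [← real_inner_self_eq_norm_sq, L2.inner_def, L2.inner_def, ← integral_const_mul]
  refine integral_mono_ae ((L2.integrable_inner g g).const_mul α) (L2.integrable_inner (T g) g) ?_
  filter_upwards [hT g, hα] with x h1 h2
  rw [h1, real_inner_self_eq_norm_sq, real_inner_comm]
  exact h2 _

theorem memLp_direction {Ω : Set (E d)} (hΩ : IsOpen Ω) {b : E d → E d}
    (hb : IsDirectionField Ω b) :
    MemLp (fun x => InnerProductSpace.rankOne ℝ (b x) (b x)) ∞ (volume.restrict Ω) := by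
  have hbm : AEStronglyMeasurable b (volume.restrict Ω) :=
    hb.smooth.continuousOn.aestronglyMeasurable hΩ.measurableSet
  have hcont : Continuous fun y : E d => InnerProductSpace.rankOne ℝ y y :=
    (InnerProductSpace.rankOne ℝ).continuous.clm_apply continuous_id
  refine memLp_top_of_bound (hcont.comp_aestronglyMeasurable hbm) 1 ?_
  filter_upwards [ae_restrict_mem hΩ.measurableSet] with x hx
  rw [InnerProductSpace.norm_rankOne, hb.norm_eq_one x hx, one_mul]

/-- `R` applies the projection `b ⊗ b` to the gradient and `S` takes the remainder; `|b| = 1` makes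
them pointwise orthogonal, hence the Pythagorean identity. -/
theorem exists_grad_operators {Ω : Set (E d)} (hΩ : IsOpen Ω) {b : E d → E d}
    (hb : IsDirectionField Ω b) :
    ∃ R S : H1 Ω →L[ℝ] L2vec Ω, (∀ φ, R φ =ᵐ[volume.restrict Ω] gradPar b φ) ∧
      (∀ φ, S φ =ᵐ[volume.restrict Ω] gradPerp b φ) ∧
      ∀ φ, ‖grad φ‖ ^ 2 = ‖R φ‖ ^ 2 + ‖S φ‖ ^ 2 := by
  obtain ⟨T, hT⟩ := exists_multiplication (memLp_direction hΩ hb)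
  have hR : ∀ φ, (T ∘L gradL Ω) φ =ᵐ[volume.restrict Ω] gradPar b φ := fun φ => by
    filter_upwards [hT (grad φ)] with x hx
    change T (grad φ) x = _
    rw [hx]
    rfl
  have hS : ∀ φ, (gradL Ω - T ∘L gradL Ω) φ =ᵐ[volume.restrict Ω] gradPerp b φ := fun φ => by
    filter_upwards [hR φ, Lp.coeFn_sub (grad φ) ((T ∘L gradL Ω) φ)] with x h1 h2
    change (grad φ - (T ∘L gradL Ω) φ : L2vec Ω) x = _
    rw [h2, Pi.sub_apply, h1]
    rfl
  refine ⟨T ∘L gradL Ω, gradL Ω - T ∘L gradL Ω, hR, hS, fun φ => ?_⟩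
  have horth : inner ℝ ((T ∘L gradL Ω) φ) ((gradL Ω - T ∘L gradL Ω) φ) = 0 := by
    rw [L2.inner_def, ← integral_zero (E d) ℝ (μ := volume.restrict Ω)]
    refine integral_congr_ae ?_
    filter_upwards [hR φ, hS φ, ae_restrict_mem hΩ.measurableSet] with x h1 h2 hx
    rw [h1, h2, gradPerp, gradPar, inner_sub_right, real_inner_smul_left, real_inner_smul_left,
      real_inner_smul_right, real_inner_self_eq_norm_sq, hb.norm_eq_one x hx]
    ring
  have hsum : grad φ = (T ∘L gradL Ω) φ + (gradL Ω - T ∘L gradL Ω) φ := by simp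
  rw [hsum, norm_add_sq_real, horth]
  ring

/-- The bilinear forms of the problem, written with bounded operators on `L²(Ω)^d`. -/
structure FormRepresentation {Ω : Set (E d)} (b : E d → E d) (Apar : E d → ℝ)
    (Aperp : E d → Matrix (Fin d) (Fin d) ℝ) (R S : H1 Ω →L[ℝ] L2vec Ω)
    (T T' : L2vec Ω →L[ℝ] L2vec Ω) : Prop where
  mem_spaceG_iff : ∀ φ, φ ∈ spaceG Ω b ↔ φ ∈ spaceV Ω b ∧ R φ = 0
  aPar_eq : ∀ φ ψ, aPar b Apar φ ψ = inner ℝ (T (R φ)) (R ψ)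
  aPerp_eq : ∀ φ ψ, aPerp b Aperp φ ψ = inner ℝ (T' (S φ)) (S ψ)

theorem memLp_sum_sum {α ι κ F : Type*} [MeasurableSpace α] [Fintype ι] [Fintype κ]
    [NormedAddCommGroup F] {μ : Measure α} {p : ℝ≥0∞} {g : ι → κ → α → F}
    (hg : ∀ i j, MemLp (g i j) p μ) : MemLp (fun x => ∑ i, ∑ j, g i j x) p μ :=
  memLp_finsetSum _ fun i _ => memLp_finsetSum _ fun j _ => hg i j

/-- Expansion in matrix units reduces boundedness of the operator field to that of the entries. -/
theorem memLp_toEuclideanCLM {Ω : Set (E d)} {A : E d → Matrix (Fin d) (Fin d) ℝ}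
    (hA : ∀ i j, MemLp (fun x => A x i j) ∞ (volume.restrict Ω)) :
    MemLp (fun x => Matrix.toEuclideanCLM (𝕜 := ℝ) (A x)) ∞ (volume.restrict Ω) := by
  have h : (fun x => Matrix.toEuclideanCLM (𝕜 := ℝ) (A x)) = fun x => ∑ i, ∑ j,
      A x i j • Matrix.toEuclideanCLM (𝕜 := ℝ) (Matrix.single i j (1 : ℝ)) := by
    funext x
    conv_lhs => rw [Matrix.matrix_eq_sum_single (A x)]
    simp only [map_sum, ← map_smul, Matrix.smul_single, smul_eq_mul, mul_one]
  rw [h]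
  have hij : ∀ i j, MemLp (fun x => A x i j •
      Matrix.toEuclideanCLM (𝕜 := ℝ) (Matrix.single i j (1 : ℝ))) ∞ (volume.restrict Ω) :=
    fun i j => ((ContinuousLinearMap.id ℝ ℝ).smulRight
      (Matrix.toEuclideanCLM (𝕜 := ℝ) (Matrix.single i j (1 : ℝ)))).comp_memLp' (hA i j)
  exact memLp_sum_sum hij

/-- The restriction to `𝒱` of an operator on `H¹(Ω)`. -/
noncomputable def restrictV {Ω : Set (E d)} (b : E d → E d) (R : H1 Ω →L[ℝ] L2vec Ω) :
    spaceV Ω b →L[ℝ] L2vec Ω :=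
  R ∘L (spaceV Ω b).subtypeL

theorem exists_formRepresentation {Ω : Set (E d)} (hΩ : IsBoundedLipschitzDomain Ω)
    {b : E d → E d} (hb : IsDirectionField Ω b) {Apar : E d → ℝ}
    {Aperp : E d → Matrix (Fin d) (Fin d) ℝ} (hA : HypothesisA Ω b Apar Aperp) :
    ∃ (R S : H1 Ω →L[ℝ] L2vec Ω) (T T' : L2vec Ω →L[ℝ] L2vec Ω) (α c : ℝ),
      FormRepresentation b Apar Aperp R S T T' ∧
      IsSplitCoercive (V := spaceV Ω b) T T' (restrictV b R) (restrictV b S) α c := by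
  obtain ⟨R, S, hR, hS, hRS⟩ := exists_grad_operators hΩ.isOpen hb
  obtain ⟨A₀, A₁, hA₀, hpar, hperp⟩ := hA.bounds
  obtain ⟨C, hC0, hC⟩ := exists_norm_val_le_norm_grad hΩ hA.interior_dirichlet
  have hMpar : MemLp (fun x => Apar x • ContinuousLinearMap.id ℝ (E d)) ∞ (volume.restrict Ω) :=
    ((ContinuousLinearMap.id ℝ ℝ).smulRight
      (ContinuousLinearMap.id ℝ (E d))).comp_memLp' hA.memLp_par
  obtain ⟨T, hT⟩ := exists_multiplication hMpar
  obtain ⟨T', hT'⟩ := exists_multiplication (memLp_toEuclideanCLM hA.memLp_perp)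
  -- With `C` the Poincaré constant, the squared `H¹` norm is at most `(C² + 1) ‖grad φ‖²`.
  refine ⟨R, S, T, T', A₀, (C ^ 2 + 1)⁻¹, ⟨fun φ => ?_, fun φ ψ => ?_, fun φ ψ => ?_⟩,
    ⟨hA₀, by positivity, fun φ => ?_, fun φ => ?_, fun φ => ?_⟩⟩
  · refine and_congr_right fun _ => ⟨fun h => Lp.ext ?_, fun h => ?_⟩
    · filter_upwards [h, hR φ, Lp.coeFn_zero (E d) 2 (volume.restrict Ω)] with x h1 h2 h3
      rw [h2, h1, h3, Pi.zero_apply]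
    · filter_upwards [hR φ, Lp.coeFn_zero (E d) 2 (volume.restrict Ω)] with x h2 h3
      rw [← h2, h, h3, Pi.zero_apply]
  · rw [aPar, L2.inner_def]
    refine integral_congr_ae ?_
    filter_upwards [hT (R φ), hR φ, hR ψ] with x h1 h2 h3
    rw [h1, h2, h3]
    exact (real_inner_smul_left _ _ _).symm
  · rw [aPerp, L2.inner_def]
    refine integral_congr_ae ?_
    filter_upwards [hT' (S φ), hS φ, hS ψ] with x h1 h2 h3
    rw [h1, h2, h3]
    rfl
  · refine mul_norm_sq_le_inner_multiplication hT ?_ _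
    filter_upwards [hpar] with x hx v
    change _ ≤ inner ℝ v (Apar x • v)
    rw [inner_smul_right, real_inner_self_eq_norm_sq]
    exact mul_le_mul_of_nonneg_right hx.1 (sq_nonneg _)
  · refine mul_norm_sq_le_inner_multiplication hT' ?_ _
    filter_upwards [hperp] with x hx v using (hx v).1
  · change _ ≤ ‖R (φ : H1 Ω)‖ ^ 2 + ‖S (φ : H1 Ω)‖ ^ 2
    rw [← hRS, Submodule.coe_norm, norm_sq_eq, inv_mul_le_iff₀ (by positivity)]
    have := pow_le_pow_left₀ (norm_nonneg _) (hC φ φ.2) 2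
    nlinarith

/-! ### The asymptotic preserving reformulation -/

/-- Such a function is `L²`-orthogonal to itself. -/
theorem eq_zero_of_mem_spaceG_of_mem_spaceA {Ω : Set (E d)} (hΩ : IsOpen Ω) {b : E d → E d}
    {φ : H1 Ω} (hG : φ ∈ spaceG Ω b) (hA : φ ∈ spaceA Ω b) : φ = 0 :=
  eq_zero_of_val_eq_zero hΩ (inner_self_eq_zero.1 (hA.2 φ hG))

namespace FormRepresentation

variable {Ω : Set (E d)} {b : E d → E d} {Apar : E d → ℝ}
  {Aperp : E d → Matrix (Fin d) (Fin d) ℝ} {R S : H1 Ω →L[ℝ] L2vec Ω}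
  {T T' : L2vec Ω →L[ℝ] L2vec Ω} {f : L2 Ω} {ε : ℝ}

theorem isSolutionP_add (h : FormRepresentation b Apar Aperp R S T T')
    (hV : spaceG Ω b ⊔ spaceA Ω b = spaceV Ω b) {p q : H1 Ω}
    (hpq : IsSolutionAP b Apar Aperp f ε p q) : IsSolutionP b Apar Aperp f ε (p + q) := by
  obtain ⟨hp, hq, h1, h2⟩ := hpq
  refine ⟨add_mem hp.1 hq.1, fun ψ hψ => ?_⟩
  rw [← hV] at hψ
  obtain ⟨η, hη, ξ, hξ, rfl⟩ := Submodule.mem_sup.1 hψ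
  have e1 := h1 η hη
  have e2 := h2 ξ hξ
  have hRp := ((h.mem_spaceG_iff p).1 hp).2
  have hRη := ((h.mem_spaceG_iff η).1 hη).2
  have hval : val (η + ξ) = val η + val ξ := rfl
  simp only [h.aPar_eq, h.aPerp_eq] at e1 e2 ⊢
  simp only [map_add, hRp, hRη, zero_add, hval, inner_add_left, inner_add_right]
  -- All parallel terms involving `p` or `η` have vanished, so (P) is `ε` times the first equation
  -- plus the second.
  linear_combination ε * e1 + e2

/-- Testing (P) in `𝒢` kills the parallel form and leaves a common factor `ε` to cancel; testing in
`𝒜` gives the second equation since `R p = 0`. -/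
theorem isSolutionAP_of_isSolutionP (h : FormRepresentation b Apar Aperp R S T T') (hε : 0 < ε)
    {φ p : H1 Ω} (hφ : IsSolutionP b Apar Aperp f ε φ) (hp : p ∈ spaceG Ω b)
    (hφp : φ - p ∈ spaceA Ω b) : IsSolutionAP b Apar Aperp f ε p (φ - p) := by
  have hRp := ((h.mem_spaceG_iff p).1 hp).2
  refine ⟨hp, hφp, fun η hη => ?_, fun ξ hξ => ?_⟩
  · have hRη := ((h.mem_spaceG_iff η).1 hη).2
    have e := hφ.2 η hη.1
    simp only [h.aPar_eq, h.aPerp_eq, hRη, inner_zero_right, zero_add] at e ⊢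
    rw [← mul_left_cancel₀ hε.ne' e, map_sub, map_sub, inner_sub_left]
    ring
  · have e := hφ.2 ξ hξ.1
    simp only [h.aPar_eq, h.aPerp_eq, map_sub, hRp, sub_zero, inner_sub_left] at e ⊢
    linear_combination e

end FormRepresentation

/-- The complement `φ - P φ` of the `L²`-orthogonal projection onto `𝒢` lies in `𝒜`. -/
theorem sub_projection_mem_spaceA {Ω : Set (E d)} {b : E d → E d}
    {P : spaceV Ω b →L[ℝ] spaceG Ω b}
    (hP : ∀ (φ : spaceV Ω b) (ψ : spaceG Ω b),
      inner ℝ (val (P φ : H1 Ω)) (val (ψ : H1 Ω)) = inner ℝ (val (φ : H1 Ω)) (val (ψ : H1 Ω)))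
    (φ : spaceV Ω b) : (φ : H1 Ω) - (P φ : H1 Ω) ∈ spaceA Ω b := by
  refine ⟨sub_mem φ.2 (P φ).2.1, fun ψ hψ => ?_⟩
  have : val ((φ : H1 Ω) - (P φ : H1 Ω)) = val (φ : H1 Ω) - val (P φ : H1 Ω) := rfl
  rw [this, inner_sub_left, hP φ ⟨ψ, hψ⟩, sub_self]

theorem exists_bound_of_submodule {H : Type*} [NormedAddCommGroup H] [NormedSpace ℝ H]
    {V G : Submodule ℝ H} (P : V →L[ℝ] G) :
    ∃ M : ℝ, 0 ≤ M ∧ ∀ φ : V, ‖(P φ : H)‖ ≤ M * ‖(φ : H)‖ :=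
  ⟨‖P‖, P.opNorm_nonneg, fun φ => P.le_opNorm φ⟩

theorem norm_innerSL_comp_subtypeL_le {L H : Type*} [NormedAddCommGroup L]
    [InnerProductSpace ℝ L] [NormedAddCommGroup H] [NormedSpace ℝ H] (V : Submodule ℝ H) (f : L)
    (J : H →L[ℝ] L) (hJ : ∀ v, ‖J v‖ ≤ ‖v‖) : ‖innerSL ℝ f ∘L J ∘L V.subtypeL‖ ≤ ‖f‖ :=
  ContinuousLinearMap.opNorm_le_bound _ (norm_nonneg _) fun v =>
    (norm_inner_le_norm f (J v)).trans (mul_le_mul_of_nonneg_left (hJ v) (norm_nonneg _))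

/-- The functional `ψ ↦ (f, ψ)` on `𝒱`. -/
noncomputable def source {Ω : Set (E d)} (b : E d → E d) (f : L2 Ω) : spaceV Ω b →L[ℝ] ℝ :=
  innerSL ℝ f ∘L valL Ω ∘L (spaceV Ω b).subtypeL

theorem norm_source_le {Ω : Set (E d)} {b : E d → E d} (f : L2 Ω) : ‖source b f‖ ≤ ‖f‖ :=
  norm_innerSL_comp_subtypeL_le (spaceV Ω b) f (valL Ω) norm_val_le

/-! ### Problems (P) and (L) as instances of the abstract theory on `𝒱` -/

section Problems

variable {Ω : Set (E d)} {b : E d → E d} {Apar : E d → ℝ}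
  {Aperp : E d → Matrix (Fin d) (Fin d) ℝ} {R S : H1 Ω →L[ℝ] L2vec Ω}
  {T T' : L2vec Ω →L[ℝ] L2vec Ω} {f : L2 Ω} {α c : ℝ}

theorem FormRepresentation.isSolutionP_iff (h : FormRepresentation b Apar Aperp R S T T') {ε : ℝ}
    (φ : spaceV Ω b) : IsSolutionP b Apar Aperp f ε φ ↔ ∀ ψ : spaceV Ω b,
      inner ℝ (T (restrictV b R φ)) (restrictV b R ψ)
        + ε * inner ℝ (T' (restrictV b S φ)) (restrictV b S ψ) = ε * source b f ψ := by
  refine ⟨fun hφ ψ => ?_, fun hφ => ⟨φ.2, fun ψ hψ => ?_⟩⟩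
  · have := hφ.2 ψ ψ.2
    rw [h.aPar_eq, h.aPerp_eq] at this
    exact this
  · rw [h.aPar_eq, h.aPerp_eq]
    exact hφ ⟨ψ, hψ⟩

theorem FormRepresentation.isSolutionL_iff (h : FormRepresentation b Apar Aperp R S T T')
    (φ : spaceV Ω b) : IsSolutionL b Aperp f φ ↔ restrictV b R φ = 0 ∧
      ∀ ψ : spaceV Ω b, restrictV b R ψ = 0 →
        inner ℝ (T' (restrictV b S φ)) (restrictV b S ψ) = source b f ψ := by
  refine ⟨fun hφ => ⟨((h.mem_spaceG_iff _).1 hφ.1).2, fun ψ hψ => ?_⟩,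
    fun hφ => ⟨(h.mem_spaceG_iff _).2 ⟨φ.2, hφ.1⟩, fun ψ hψ => ?_⟩⟩
  · have := hφ.2 ψ ((h.mem_spaceG_iff _).2 ⟨ψ.2, hψ⟩)
    rw [h.aPerp_eq] at this
    exact this
  · rw [h.aPerp_eq]
    exact hφ.2 ⟨ψ, hψ.1⟩ ((h.mem_spaceG_iff _).1 hψ).2

theorem FormRepresentation.exists_solutionP (h : FormRepresentation b Apar Aperp R S T T')
    (hco : IsSplitCoercive (V := spaceV Ω b) T T' (restrictV b R) (restrictV b S) α c)
    (f : L2 Ω) {ε : ℝ} (hε : 0 < ε) :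
    ∃ φ : spaceV Ω b, IsSolutionP b Apar Aperp f ε φ ∧
      ∀ φ' : H1 Ω, IsSolutionP b Apar Aperp f ε φ' → φ' = φ := by
  obtain ⟨φ, hφ, huniq⟩ := hco.existsUnique_perturbed (source b f) hε
  exact ⟨φ, (h.isSolutionP_iff φ).2 hφ, fun φ' hφ' =>
    congrArg Subtype.val (huniq ⟨φ', hφ'.1⟩ ((h.isSolutionP_iff ⟨φ', hφ'.1⟩).1 hφ'))⟩

theorem FormRepresentation.exists_solutionL (h : FormRepresentation b Apar Aperp R S T T')
    (hco : IsSplitCoercive (V := spaceV Ω b) T T' (restrictV b R) (restrictV b S) α c)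
    (f : L2 Ω) :
    ∃ φ : spaceV Ω b, IsSolutionL b Aperp f φ ∧
      ∀ φ' : H1 Ω, IsSolutionL b Aperp f φ' → φ' = φ := by
  obtain ⟨φ, hR, hφ⟩ := hco.exists_limit (source b f)
  refine ⟨φ, (h.isSolutionL_iff φ).2 ⟨hR, hφ⟩, fun φ' hφ' => ?_⟩
  obtain ⟨hR', hφ''⟩ := (h.isSolutionL_iff ⟨φ', hφ'.1.1⟩).1 hφ'
  exact congrArg Subtype.val (hco.eq_of_limit hR hφ hR' hφ'')

theorem FormRepresentation.norm_le_of_isSolutionP (h : FormRepresentation b Apar Aperp R S T T')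
    (hco : IsSplitCoercive (V := spaceV Ω b) T T' (restrictV b R) (restrictV b S) α c)
    {ε : ℝ} (hε : 0 < ε) (hε1 : ε < 1) (φ : spaceV Ω b) (hφ : IsSolutionP b Apar Aperp f ε φ) :
    ‖(φ : H1 Ω)‖ ≤ (α * c)⁻¹ * ‖f‖ := by
  have hαc : 0 < α * c := mul_pos hco.pos_left hco.pos_right
  exact (hco.norm_le hε hε1 ((h.isSolutionP_iff φ).1 hφ)).trans
    (mul_le_mul_of_nonneg_left (norm_source_le f) (inv_nonneg.2 hαc.le))

theorem FormRepresentation.tendsto_solutionP (h : FormRepresentation b Apar Aperp R S T T')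
    (hco : IsSplitCoercive (V := spaceV Ω b) T T' (restrictV b R) (restrictV b S) α c)
    {φ : ℝ → spaceV Ω b} {φ₀ : spaceV Ω b}
    (hφ : ∀ ε, 0 < ε → IsSolutionP b Apar Aperp f ε (φ ε)) (hφ₀ : IsSolutionL b Aperp f φ₀) :
    Tendsto φ (𝓝[>] 0) (𝓝 φ₀) :=
  hco.tendsto (fun ε hε => (h.isSolutionP_iff (φ ε)).1 (hφ ε hε))
    ((h.isSolutionL_iff φ₀).1 hφ₀).1 ((h.isSolutionL_iff φ₀).1 hφ₀).2

end Problems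

end AnisotropicAP

/-! ### Assembly of the main theorem -/

theorem theorem1 {d : ℕ} (hd : d = 2 ∨ d = 3)
    (Ω : Set (AnisotropicAP.E d)) (hΩ : AnisotropicAP.IsBoundedLipschitzDomain Ω)
    (b : AnisotropicAP.E d → AnisotropicAP.E d) (hb : AnisotropicAP.IsDirectionField Ω b)
    (Apar : AnisotropicAP.E d → ℝ) (Aperp : AnisotropicAP.E d → Matrix (Fin d) (Fin d) ℝ)
    (hA : AnisotropicAP.HypothesisA Ω b Apar Aperp) (hB : AnisotropicAP.HypothesisB Ω b) :
    ∃ C : ℝ, 0 < C ∧ ∀ f : AnisotropicAP.L2 Ω,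
      ∃ (p q : ℝ → AnisotropicAP.H1 Ω) (φ₀ : AnisotropicAP.H1 Ω),
        -- well-posedness, for every `ε > 0`
        (∀ ε : ℝ, 0 < ε →
          AnisotropicAP.IsSolutionAP b Apar Aperp f ε (p ε) (q ε) ∧
          (∀ p' q' : AnisotropicAP.H1 Ω,
            AnisotropicAP.IsSolutionAP b Apar Aperp f ε p' q' → p' = p ε ∧ q' = q ε) ∧
          AnisotropicAP.IsSolutionP b Apar Aperp f ε (p ε + q ε) ∧
          (∀ φ' : AnisotropicAP.H1 Ω,
            AnisotropicAP.IsSolutionP b Apar Aperp f ε φ' → φ' = p ε + q ε)) ∧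
        -- bounds, uniform in `0 < ε < 1`
        (∀ ε : ℝ, 0 < ε → ε < 1 →
          ‖p ε + q ε‖ ≤ C * ‖f‖ ∧ ‖q ε‖ ≤ C * ‖f‖ ∧ ‖p ε‖ ≤ C * ‖f‖) ∧
        -- the limit problem
        AnisotropicAP.IsSolutionL b Aperp f φ₀ ∧
        (∀ φ' : AnisotropicAP.H1 Ω, AnisotropicAP.IsSolutionL b Aperp f φ' → φ' = φ₀) ∧
        -- strong convergence in `H¹(Ω)`
        Tendsto (fun ε => p ε + q ε) (𝓝[>] 0) (𝓝 φ₀) ∧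
        Tendsto p (𝓝[>] 0) (𝓝 φ₀) ∧
        Tendsto q (𝓝[>] 0) (𝓝 0) := by
  obtain ⟨R, S, T, T', α, c, hrep, hco⟩ := AnisotropicAP.exists_formRepresentation hΩ hb hA
  obtain ⟨P, hP, -⟩ := hB.projection
  obtain ⟨M, hM0, hM⟩ := AnisotropicAP.exists_bound_of_submodule P
  have hαc : 0 < α * c := mul_pos hco.pos_left hco.pos_right
  have hPA := AnisotropicAP.sub_projection_mem_spaceA hP
  -- The worst case is `q = φ - P φ`, bounded by `(1 + M) ‖φ‖`.
  refine ⟨(1 + M) * (α * c)⁻¹, by positivity, fun f => ?_⟩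
  have hex : ∀ ε : ℝ, ∃ φ : AnisotropicAP.spaceV Ω b, 0 < ε →
      AnisotropicAP.IsSolutionP b Apar Aperp f ε φ ∧
      ∀ φ' : AnisotropicAP.H1 Ω, AnisotropicAP.IsSolutionP b Apar Aperp f ε φ' → φ' = φ := by
    intro ε
    by_cases hε : 0 < ε
    · obtain ⟨φ, hφ⟩ := hrep.exists_solutionP hco f hε
      exact ⟨φ, fun _ => hφ⟩
    · exact ⟨0, fun h => absurd h hε⟩
  choose φ hφ using hex
  obtain ⟨φ₀, hφ₀, hφ₀u⟩ := hrep.exists_solutionL hco f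
  -- `φ₀ - P φ₀` lies in both `𝒢` and `𝒜`.
  have hPφ₀ : (P φ₀ : AnisotropicAP.H1 Ω) = φ₀ :=
    (sub_eq_zero.1 (AnisotropicAP.eq_zero_of_mem_spaceG_of_mem_spaceA hΩ.isOpen
      (sub_mem hφ₀.1 (P φ₀).2) (hPA φ₀))).symm
  have hlim : Tendsto φ (𝓝[>] 0) (𝓝 φ₀) :=
    hrep.tendsto_solutionP hco (fun ε hε => (hφ ε hε).1) hφ₀
  have hlim₁ : Tendsto (fun ε => (φ ε : AnisotropicAP.H1 Ω)) (𝓝[>] 0) (𝓝 φ₀) :=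
    (continuous_subtype_val.tendsto φ₀).comp hlim
  have hlim₂ : Tendsto (fun ε => (P (φ ε) : AnisotropicAP.H1 Ω)) (𝓝[>] 0) (𝓝 φ₀) := by
    have h := ((continuous_subtype_val.comp P.continuous).tendsto φ₀).comp hlim
    rwa [Function.comp_apply, hPφ₀] at h
  refine ⟨fun ε => P (φ ε), fun ε => (φ ε : AnisotropicAP.H1 Ω) - P (φ ε), φ₀,
    fun ε hε => ⟨?_, ?_, ?_, ?_⟩, fun ε hε hε1 => ?_, hφ₀, hφ₀u, ?_, hlim₂, ?_⟩
  · exact hrep.isSolutionAP_of_isSolutionP hε (hφ ε hε).1 (P (φ ε)).2 (hPA (φ ε))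
  · intro p' q' hpq
    -- The sum solves (P), so it is `φ ε`; then `p' - P (φ ε) = (φ ε - P (φ ε)) - q'` lies in `𝒢 ∩
    -- 𝒜`.
    have hsum : p' + q' = φ ε := (hφ ε hε).2 _ (hrep.isSolutionP_add hB.decomposition hpq)
    have hp : p' - P (φ ε) = 0 := by
      refine AnisotropicAP.eq_zero_of_mem_spaceG_of_mem_spaceA hΩ.isOpen
        (sub_mem hpq.1 (P (φ ε)).2) ?_
      have h1 := sub_mem (hPA (φ ε)) hpq.2.1
      rwa [← hsum, sub_sub, add_sub_add_right_eq_sub] at h1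
    exact ⟨sub_eq_zero.1 hp, eq_sub_of_add_eq' ((sub_eq_zero.1 hp) ▸ hsum)⟩
  · simp only [add_sub_cancel]
    exact (hφ ε hε).1
  · simp only [add_sub_cancel]
    exact (hφ ε hε).2
  · have h0 := hrep.norm_le_of_isSolutionP hco hε hε1 (φ ε) (hφ ε hε).1
    have h1 : ‖(P (φ ε) : AnisotropicAP.H1 Ω)‖ ≤ M * ((α * c)⁻¹ * ‖f‖) :=
      (hM (φ ε)).trans (mul_le_mul_of_nonneg_left h0 hM0)
    have h2 : 0 ≤ (α * c)⁻¹ * ‖f‖ := by positivity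
    have h3 := mul_nonneg hM0 h2
    have h4 := norm_sub_le (φ ε : AnisotropicAP.H1 Ω) (P (φ ε))
    simp only [add_sub_cancel, one_add_mul] at *
    exact ⟨by linarith, by linarith, by linarith⟩
  · simpa only [add_sub_cancel] using hlim₁
  · simpa only [sub_self] using hlim₁.sub hlim₂
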